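/- Let $P>0$ and let $V\colon\mathbb R\to\mathbb R$. For $N\ge 1$ let $\mathbb P^{V,P}_N$ be the probability measure on $\mathbb R^N$ with density proportional to $$\prod_{i<j}|x_i-x_j|^{2P/N}\,e^{-\sum_{i=1}^N V(x_i)},$$ and let $\hat\mu_N=\frac1N\sum_{i=1}^N\delta_{x_i}$ be the empirical measure of $(x_1,\dots,x_N)$. Let $\mu^P_V$ be the equilibrium measure, that is, the minimizer over all probability measures $\mu$ on $\mathbb R$ of the energy $$\mathcal E^P_V(\mu)=\int_{\mathbb R}\Big[V+\ln\frac{d\mu}{dx}\Big]d\mu-P\iint_{\mathbb R^2}\ln|x-y|\,d\mu(x)\,d\mu(y)\quad\text{if }\mu\ll dx,\qquad \mathcal E^P_V(\mu)=+\infty\quad\text{otherwise}$$ (the energy is also $+\infty$ if one of the two integrals does not converge absolutely). Assume: (i) $V\in\mathcal C^3(\mathbb R)$, $V(x)\to+\infty$ and $|V'(x)|\to+\infty$ as $|x|\to\infty$, and $\mu^P_V$ satisfies the Poincaré inequality: there is $C>0$ such that $\int\big(f-\int f\,d\mu^P_V\big)^2d\mu^P_V\le C\int|f'|^2\,d\mu^P_V$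 for all compactly supported $f\in\mathcal C^1(\mathbb R)$; (ii) for every real polynomial $Q$ and every $\alpha>0$, $Q(V'(x))\,e^{-V(x)}=o(|x|^{-\alpha})$ as $|x|\to\infty$; (iii) for every real sequence $(u_n)$ with $|u_n|\to\infty$ and all real $a<b$, $\frac{1}{V'(u_n)^2}\sup_{a\le x\le b}|V''(u_n+x)|\to0$ as $n\to\infty$; (iv) $x\mapsto V'(x)^{-2}$ is integrable at infinity, and $V''(x)/V'(x)=O(1)$ and $V^{(3)}(x)/V'(x)=O(1)$ as $|x|\to\infty$. For probability measures $\mu,\mu'$ on $\mathbb R$ put $$d(\mu,\mu')=\sup\Big\{\Big|\int f\,d\mu-\int f\,d\mu'\Big| : f\in L^2(\mathbb R)\text{ real-valued},\ \|f\|_{\mathrm{Lip}}\le1,\ \|f\|_{1/2}\le1\Big\}\in[0,+\infty],$$ where $\|f\|_{\mathrm{Lip}}$ is the Lipschitz constant of $f$ and $\|f\|_{1/2}^2=\int_{\mathbb R}|t|\,|\mathcal F[f](t)|^2\,dt$, with $\mathcal F$ the Fourier transform on $L^2(\mathbb R)$ given by $\mathcal F[f](t)=\int_{\mathbb R}f(x)e^{-\mathrm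 i tx}\,dx$ for $f\in L^1(\mathbb R)\cap L^2(\mathbb R)$. Then there is a constant $K\in\mathbb R$, depending on $V$ and $P$, such that for all $N\ge1$ and all $r>0$, $$\mathbb P^{V,P}_N\big(d(\hat\mu_N,\mu^P_V)>r\big)\le\exp\Big(-Nr^2\,\frac{P\pi^2}{2}+5P\ln N+K\Big).$$ -/

import Mathlib

open MeasureTheory Filter Topology Asymptotics
open scoped ENNReal FourierTransform

noncomputable section

namespace HighTempBeta

/-- The unnormalised density `∏_{i<j} |x_i - x_j|^{2P/N} e^{-∑ V(x_i)}` on `ℝ^N`. -/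
def weight (V : ℝ → ℝ) (P : ℝ) (N : ℕ) (x : Fin N → ℝ) : ℝ :=
  (∏ i, ∏ j ∈ Finset.Ioi i, |x i - x j| ^ (2 * P / (N : ℝ))) * Real.exp (-∑ i, V (x i))

/-- The partition function, i.e. the integral of `weight` over `ℝ^N`. -/
def partitionFunction (V : ℝ → ℝ) (P : ℝ) (N : ℕ) : ℝ≥0∞ :=
  ∫⁻ x : Fin N → ℝ, ENNReal.ofReal (weight V P N x)

/-- The `β`-ensemble on `ℝ^N` at inverse temperature `β = 2P/N` with potential `V`. -/
def betaEnsemble (V : ℝ → ℝ) (P : ℝ) (N : ℕ) : Measure (Fin N → ℝ) :=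
  (partitionFunction V P N)⁻¹ •
    (volume : Measure (Fin N → ℝ)).withDensity fun x => ENNReal.ofReal (weight V P N x)

/-- The empirical measure `(1/N) ∑ δ_{x_i}`. -/
def empiricalMeasure (N : ℕ) (x : Fin N → ℝ) : Measure ℝ :=
  (N : ℝ≥0∞)⁻¹ • ∑ i, Measure.dirac (x i)

/-- The density `dμ/dx` of the absolutely continuous part of `μ`; it is the density of `μ`
when `μ ≪ dx`. -/
def density (μ : Measure ℝ) (x : ℝ) : ℝ := (μ.rnDeriv volume x).toReal

open Classical in
/-- The energy `∫ [V + ln (dμ/dx)] dμ - P ∬ ln|x - y| dμ(x) dμ(y)` of a probability measure `μ`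
if `μ ≪ dx`, and `+∞` otherwise. The value is `+∞` also if one of the two integrals does not
converge absolutely: for `∫ e^{-V} dx < ∞` the negative part of the first integrand is
integrable, so that the first integral is then `+∞`; and for `V` growing faster than linearly
the first integral can only converge if the second one does. -/
def energy (V : ℝ → ℝ) (P : ℝ) (μ : Measure ℝ) : EReal :=
  if μ ≪ volume ∧ Integrable (fun x => V x + Real.log (density μ x)) μ ∧
      Integrable (fun p : ℝ × ℝ => Real.log |p.1 - p.2|) (μ.prod μ) then
    (((∫ x, (V x + Real.log (density μ x)) ∂μ) -
      P * ∫ p : ℝ × ℝ, Real.log |p.1 - p.2| ∂(μ.prod μ) : ℝ) : EReal)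
  else ⊤

/-- `μ` is the equilibrium measure: a probability measure that minimises the energy among all
probability measures on `ℝ`. -/
structure IsEquilibriumMeasure (V : ℝ → ℝ) (P : ℝ) (μ : Measure ℝ) : Prop where
  isProbabilityMeasure : IsProbabilityMeasure μ
  energy_le : ∀ ν : Measure ℝ, IsProbabilityMeasure ν → energy V P μ ≤ energy V P ν

/-- The Poincaré inequality for a probability measure on `ℝ`. -/
def SatisfiesPoincare (μ : Measure ℝ) : Prop :=
  ∃ C : ℝ, 0 < C ∧ ∀ f : ℝ → ℝ, ContDiff ℝ 1 f → HasCompactSupport f →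
    ∫ x, (f x - ∫ y, f y ∂μ) ^ 2 ∂μ ≤ C * ∫ x, |deriv f x| ^ 2 ∂μ

/-- The assumptions on the potential `V`; `μ` is its equilibrium measure. The filter
`cocompact ℝ` is `|x| → ∞`. -/
structure PotentialAssumptions (V : ℝ → ℝ) (μ : Measure ℝ) : Prop where
  contDiff : ContDiff ℝ 3 V
  tendsto_potential : Tendsto V (cocompact ℝ) atTop
  tendsto_abs_deriv : Tendsto (fun x => |deriv V x|) (cocompact ℝ) atTop
  poincare : SatisfiesPoincare μ
  poly_isLittleO : ∀ (Q : Polynomial ℝ) (α : ℝ), 0 < α →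
    (fun x => Q.eval (deriv V x) * Real.exp (-V x)) =o[cocompact ℝ] fun x => |x| ^ (-α)
  local_sup : ∀ u : ℕ → ℝ, Tendsto (fun n => |u n|) atTop atTop → ∀ a b : ℝ, a < b →
    Tendsto (fun n => 1 / (deriv V (u n)) ^ 2 *
      sSup ((fun x => |iteratedDeriv 2 V (u n + x)|) '' Set.Icc a b)) atTop (𝓝 0)
  integrable_inv_sq :
    IntegrableAtFilter (fun x => ((deriv V x) ^ 2)⁻¹) (cocompact ℝ) volume
  second_isBigO :
    (fun x => iteratedDeriv 2 V x / deriv V x) =O[cocompact ℝ] fun _ => (1 : ℝ)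
  third_isBigO :
    (fun x => iteratedDeriv 3 V x / deriv V x) =O[cocompact ℝ] fun _ => (1 : ℝ)

/-- The Fourier transform on `L²(ℝ)` that is normalised by `t ↦ ∫ f(x) e^{-itx} dx` on
`L¹ ∩ L²`. Mathlib's is normalised by `ξ ↦ ∫ f(x) e^{-2πiξx} dx`. -/
def fourierL2 (f : Lp ℂ 2 (volume : Measure ℝ)) (t : ℝ) : ℂ :=
  (𝓕 f : Lp ℂ 2 (volume : Measure ℝ)) (t / (2 * Real.pi))

/-- The square `∫ |t| |𝓕f(t)|² dt` of the `H^{1/2}` norm. -/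
def halfNormSq (f : Lp ℂ 2 (volume : Measure ℝ)) : ℝ≥0∞ :=
  ∫⁻ t : ℝ, ‖t‖ₑ * ‖fourierL2 f t‖ₑ ^ 2

/-- The functions `f ∈ L²(ℝ)` with Lipschitz constant at most `1` and `H^{1/2}` norm at
most `1`. -/
def IsTestFunction (f : ℝ → ℝ) : Prop :=
  LipschitzWith 1 f ∧
    ∃ hf : MemLp (fun x => (f x : ℂ)) 2 (volume : Measure ℝ), halfNormSq hf.toLp ≤ 1

/-- The distance of two probability measures that is dual to the test functions. -/
def dist (μ ν : Measure ℝ) : ℝ≥0∞ :=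
  ⨆ (f : ℝ → ℝ) (_ : IsTestFunction f), ENNReal.ofReal |∫ x, f x ∂μ - ∫ x, f x ∂ν|

end HighTempBeta

end

noncomputable section

namespace HighTempBeta

/-! ### The logarithmic kernel -/

/-! The proof completes a square around `μ` and reads that square as a negative Sobolev norm of the
fluctuation. Let `U` be the logarithmic potential of `μ` and let `ν` be the normalisation of `e^{-V
+ 2PU}`. The first variation of the energy from `μ` towards this one competitor says that the
relative entropy of `μ` with respect to `ν` is at most zero. Hence `μ` has density `e^{-V + 2PU -
ℓ}` (`equilibrium_eq_gibbs`), and the decay of `e^{-V}` makes this density bounded. Write `L_ε(s) =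
log(s² + ε²)/2`. In the weight, bound `log|x_i - x_j|` above by `L_ε`, restore the diagonal at the
price `-P log ε`, and expand around `μ`. The linear terms merge with `e^{-∑V}` into the density of
`μ^{⊗N}`. What remains is `exp(N P Q_ε)` with `Q_ε` the `L_ε`-energy of the signed measure `μ̂_N -
μ`, up to explicit constants (`weight_le`). Jensen's inequality under `μ^{⊗N}` bounds the partition
function below with the same leading constants (`le_partitionFunction`), so an event on which `Q_ε ≤
κ` has probability at most `exp(N P κ - P log ε + O(1 + N√ε))` (`betaEnsemble_le`). Since `μ̂_N - μ`
has mass zero, `-2 Q_ε` dominates the integral of `e^{-ε|t|}/|t|` times the squared modulus of its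
Fourier transform (`lintegral_exp_norm_charFun_sub_le`). Cutting a test function off at frequencies
`|t| ≤ 2π/h` moves it uniformly by `O(h)` because it is Lipschitz, and Cauchy-Schwarz with the
weights `|t|^{1/2}` and `|t|^{-1/2}` treats the rest (`abs_integral_sub_integral_le`). Thus `d > r`
forces `Q_ε ≤ -π²r²/2 + O(h²)` (`kernelForm_le_of_lt_dist`). With `ε = N⁻²` and `h = 16/N` the
errors add up to `2P log N + O(1)`. -/

theorem log_one_add_abs_nonneg (x : ℝ) : 0 ≤ Real.log (1 + |x|) :=
  Real.log_nonneg (by linarith [abs_nonneg x])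

theorem log_one_add_abs_sub_le (x y : ℝ) :
    Real.log (1 + |x - y|) ≤ Real.log (1 + |x|) + Real.log (1 + |y|) := by
  have hx := abs_nonneg x
  have hy := abs_nonneg y
  rw [← Real.log_mul (by positivity) (by positivity)]
  refine Real.log_le_log (by positivity) ?_
  nlinarith [abs_sub x y, mul_nonneg hx hy]

theorem log_le_two_mul_sqrt {u : ℝ} (hu : 0 ≤ u) : Real.log (1 + u) ≤ 2 * √u := by
  have hs := Real.sqrt_nonneg u
  have h1 : 1 + u ≤ (1 + √u) ^ 2 := by nlinarith [Real.sq_sqrt hu]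
  calc Real.log (1 + u) ≤ Real.log ((1 + √u) ^ 2) := Real.log_le_log (by positivity) h1
    _ = 2 * Real.log (1 + √u) := by rw [Real.log_pow]; norm_num
    _ ≤ 2 * √u := by
        have := Real.log_le_sub_one_of_pos (show 0 < 1 + √u by positivity)
        linarith

theorem abs_rpow_neg_half (s : ℝ) : |s| ^ (-(1 / 2) : ℝ) = √(|s|⁻¹) := by
  rw [Real.rpow_neg (abs_nonneg s), ← Real.sqrt_eq_rpow, Real.sqrt_inv]

theorem log_abs_le (s : ℝ) : Real.log |s| ≤ Real.log (1 + |s|) := by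
  rcases eq_or_ne s 0 with rfl | hs
  · simp
  · exact Real.log_le_log (abs_pos.mpr hs) (by linarith)

theorem neg_log_abs_le (s : ℝ) : -Real.log |s| ≤ 2 * |s| ^ (-(1 / 2) : ℝ) := by
  rw [abs_rpow_neg_half, ← Real.log_inv]
  -- At `s = 0` both sides vanish by the conventions `log 0 = 0` and `0⁻¹ = 0`.
  rcases eq_or_ne s 0 with rfl | hs
  · simp
  · have h : 0 < |s|⁻¹ := inv_pos.mpr (abs_pos.mpr hs)
    exact (Real.log_le_log h (by linarith)).trans (log_le_two_mul_sqrt h.le)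

theorem abs_log_abs_le (s : ℝ) :
    |Real.log (|s|)| ≤ Real.log (1 + |s|) + 2 * |s| ^ (-(1 / 2) : ℝ) := by
  have h1 := log_abs_le s
  have h2 := neg_log_abs_le s
  have h3 := log_one_add_abs_nonneg s
  have h4 : 0 ≤ |s| ^ (-(1 / 2) : ℝ) := by positivity
  rw [abs_le]
  constructor <;> linarith

/-- The logarithm regularised at scale `ε`. -/
def regLog (ε s : ℝ) : ℝ := Real.log (s ^ 2 + ε ^ 2) / 2

/-- The origin has to be excluded: `Real.log 0 = 0`, while `regLog ε 0 = log ε` is negative for `0 <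
ε < 1`. Coinciding points are therefore always treated separately, as a null set or through the
vanishing of the weight. -/
theorem log_abs_le_regLog (ε : ℝ) {s : ℝ} (hs : s ≠ 0) :
    Real.log |s| ≤ regLog ε s := by
  have h : Real.log (s ^ 2) ≤ Real.log (s ^ 2 + ε ^ 2) :=
    Real.log_le_log (by positivity) (by nlinarith)
  rw [Real.log_pow] at h
  rw [Real.log_abs, regLog]
  push_cast at h
  linarith

/-- Since `s² + ε² ≤ (|s| + ε)²`, the excess over `log|s|` is at most `log(1 + ε/|s|) ≤ 2√(ε/|s|)`.
The singularity `|s|^{-1/2}` is locally integrable, so regularising costs only `O(√ε)` against a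
bounded density. -/
theorem regLog_le {ε : ℝ} (hε : 0 < ε) {s : ℝ} (hs : s ≠ 0) :
    regLog ε s ≤ Real.log |s| + 2 * √ε * |s| ^ (-(1 / 2) : ℝ) := by
  have hs' : 0 < |s| := abs_pos.mpr hs
  have h1 : s ^ 2 + ε ^ 2 ≤ (|s| * (1 + ε * |s|⁻¹)) ^ 2 := by
    have : |s| * (1 + ε * |s|⁻¹) = |s| + ε := by field_simp
    rw [this]
    nlinarith [sq_abs s, mul_pos hε hs']
  have h2 : regLog ε s ≤ Real.log (|s| * (1 + ε * |s|⁻¹)) := by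
    have h := Real.log_le_log (by positivity) h1
    rw [Real.log_pow] at h
    rw [regLog]
    push_cast at h
    linarith
  rw [Real.log_mul (by positivity) (by positivity)] at h2
  have h3 := log_le_two_mul_sqrt (show 0 ≤ ε * |s|⁻¹ by positivity)
  rw [Real.sqrt_mul hε.le] at h3
  rw [abs_rpow_neg_half]
  linarith

theorem abs_regLog_le {ε : ℝ} (hε : 0 < ε) (s : ℝ) :
    |regLog ε s| ≤ Real.log (1 + |s|) + (|Real.log ε| + Real.log (1 + ε)) := by
  have h0 := abs_nonneg s
  have h1 : ε ^ 2 ≤ s ^ 2 + ε ^ 2 := by nlinarith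
  have h2 : s ^ 2 + ε ^ 2 ≤ ((1 + |s|) * (1 + ε)) ^ 2 := by
    have : |s| + ε ≤ (1 + |s|) * (1 + ε) := by nlinarith [mul_nonneg h0 hε.le]
    calc s ^ 2 + ε ^ 2 ≤ (|s| + ε) ^ 2 := by nlinarith [sq_abs s, mul_nonneg h0 hε.le]
      _ ≤ _ := by gcongr
  have h3 := Real.log_le_log (by positivity) h1
  have h4 := Real.log_le_log (by positivity) h2
  rw [Real.log_pow] at h3 h4
  rw [Real.log_mul (by positivity) (by positivity)] at h4
  have h5 := log_one_add_abs_nonneg s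
  have h6 : 0 ≤ Real.log (1 + ε) := Real.log_nonneg (by linarith)
  have h7 := neg_abs_le (Real.log ε)
  have h8 := abs_nonneg (Real.log ε)
  push_cast at h3 h4
  rw [regLog, abs_le]
  constructor <;> linarith

theorem measurable_regLog (ε : ℝ) : Measurable (regLog ε) := by
  unfold regLog
  fun_prop

/-! ### Measures with a bounded density and a logarithmic moment -/

/-- A probability measure on `ℝ` that integrates `log (1 + |x|)`. -/
structure HasLogMoment (μ : Measure ℝ) : Prop where
  isProbabilityMeasure : IsProbabilityMeasure μ
  integrable : Integrable (fun x => Real.log (1 + |x|)) μ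

/-- A measure on `ℝ` that is dominated by a multiple of Lebesgue measure. -/
def HasBoundedDensity (μ : Measure ℝ) : Prop :=
  ∃ M : ℝ≥0∞, M ≠ ∞ ∧ μ ≤ M • (volume : Measure ℝ)

theorem HasBoundedDensity.absolutelyContinuous {μ : Measure ℝ} (h : HasBoundedDensity μ) :
    μ ≪ volume := by
  obtain ⟨M, -, hM⟩ := h
  exact (Measure.absolutelyContinuous_of_le hM).trans Measure.smul_absolutelyContinuous

theorem HasBoundedDensity.nullSingletonClass {μ : Measure ℝ} (h : HasBoundedDensity μ) :
    NullSingletonClass μ :=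
  ⟨fun _ => h.absolutelyContinuous (measure_singleton _)⟩

theorem setLIntegral_abs_rpow_neg_half_lt_top :
    ∫⁻ s in Set.Icc (-1 : ℝ) 1, ENNReal.ofReal (|s| ^ (-(1 / 2) : ℝ)) < ∞ := by
  have h1 : IntervalIntegrable (fun s : ℝ => |s| ^ (-(1 / 2) : ℝ)) volume 0 1 := by
    refine (intervalIntegral.intervalIntegrable_rpow' (r := -(1 / 2)) (by norm_num)).congr ?_
    intro s hs
    rw [Set.uIoc_of_le zero_le_one] at hs
    simp [abs_of_pos hs.1]
  have h2 : IntervalIntegrable (fun s : ℝ => |s| ^ (-(1 / 2) : ℝ)) volume (-1) 0 := by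
    rw [IntervalIntegrable.iff_comp_neg]
    simpa using h1.symm
  have h3 := h2.trans h1
  rw [intervalIntegrable_iff_integrableOn_Icc_of_le (by norm_num)] at h3
  exact h3.lintegral_lt_top

/-- For `|x - y| > 1` the kernel is at most `1` and `μ` has mass one; near `x`, Lebesgue measure is
translation invariant. This is why the bound is uniform in `x`. -/
theorem HasBoundedDensity.exists_lintegral_rpow_le {μ : Measure ℝ} [IsProbabilityMeasure μ]
    (h : HasBoundedDensity μ) :
    ∃ C : ℝ, 0 ≤ C ∧ ∀ x : ℝ,
      ∫⁻ y, ENNReal.ofReal (|x - y| ^ (-(1 / 2) : ℝ)) ∂μ ≤ ENNReal.ofReal C := by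
  obtain ⟨M, hM, hμ⟩ := h
  set A := ∫⁻ s in Set.Icc (-1 : ℝ) 1, ENNReal.ofReal (|s| ^ (-(1 / 2) : ℝ)) with hA
  have hA' : A ≠ ∞ := setLIntegral_abs_rpow_neg_half_lt_top.ne
  have hfin : 1 + M * A ≠ ∞ := by finiteness
  refine ⟨(1 + M * A).toReal, ENNReal.toReal_nonneg, fun x => ?_⟩
  rw [ENNReal.ofReal_toReal hfin]
  set k : ℝ → ℝ≥0∞ := (Set.Icc (-1 : ℝ) 1).indicator
    fun s => ENNReal.ofReal (|s| ^ (-(1 / 2) : ℝ)) with hk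
  have hkm : Measurable k := by
    refine Measurable.indicator ?_ measurableSet_Icc
    fun_prop
  have hle : ∀ y, ENNReal.ofReal (|x - y| ^ (-(1 / 2) : ℝ)) ≤ 1 + k (x - y) := by
    intro y
    by_cases hy : x - y ∈ Set.Icc (-1 : ℝ) 1
    · rw [hk, Set.indicator_of_mem hy]
      exact le_add_self
    · refine le_add_right ?_
      have h1 : 1 ≤ |x - y| := by
        by_contra hc
        exact hy (abs_le.mp (not_le.mp hc).le)
      rw [← ENNReal.ofReal_one]
      exact ENNReal.ofReal_le_ofReal (Real.rpow_le_one_of_one_le_of_nonpos h1 (by norm_num))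
  calc ∫⁻ y, ENNReal.ofReal (|x - y| ^ (-(1 / 2) : ℝ)) ∂μ
      ≤ ∫⁻ y, (1 + k (x - y)) ∂μ := lintegral_mono hle
    _ = 1 + ∫⁻ y, k (x - y) ∂μ := by
        rw [lintegral_add_left measurable_const]
        simp
    _ ≤ 1 + ∫⁻ y, k (x - y) ∂(M • volume) := by
        gcongr
    _ = 1 + M * A := by
        rw [lintegral_smul_measure, lintegral_sub_left_eq_self, hk,
          lintegral_indicator measurableSet_Icc, smul_eq_mul]

theorem HasBoundedDensity.exists_integral_rpow_le {μ : Measure ℝ} [IsProbabilityMeasure μ]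
    (h : HasBoundedDensity μ) :
    ∃ C : ℝ, 0 ≤ C ∧ ∀ x : ℝ, Integrable (fun y => |x - y| ^ (-(1 / 2) : ℝ)) μ ∧
      ∫ y, |x - y| ^ (-(1 / 2) : ℝ) ∂μ ≤ C := by
  obtain ⟨C, hC, hb⟩ := h.exists_lintegral_rpow_le
  have hm : ∀ x : ℝ, Measurable fun y : ℝ => |x - y| ^ (-(1 / 2) : ℝ) := fun x => by fun_prop
  have hnn : ∀ x : ℝ, 0 ≤ᵐ[μ] fun y : ℝ => |x - y| ^ (-(1 / 2) : ℝ) := fun x =>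
    ae_of_all _ fun y => by positivity
  refine ⟨C, hC, fun x => ⟨⟨(hm x).aestronglyMeasurable, ?_⟩, ?_⟩⟩
  · rw [hasFiniteIntegral_iff_ofReal (hnn x)]
    exact (hb x).trans_lt ENNReal.ofReal_lt_top
  · rw [integral_eq_lintegral_of_nonneg_ae (hnn x) (hm x).aestronglyMeasurable]
    exact ENNReal.toReal_le_of_le_ofReal hC (hb x)

theorem HasLogMoment.integrable_log_sub {μ : Measure ℝ} (h : HasLogMoment μ) (x : ℝ) :
    Integrable (fun y => Real.log (1 + |x - y|)) μ := by
  have := h.isProbabilityMeasure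
  refine ((integrable_const (Real.log (1 + |x|))).add h.integrable).mono'
    (Measurable.aestronglyMeasurable (by fun_prop)) (ae_of_all _ fun y => ?_)
  rw [Real.norm_of_nonneg (log_one_add_abs_nonneg _)]
  exact log_one_add_abs_sub_le x y

theorem HasLogMoment.integrable_log_prod {μ ν : Measure ℝ} (h : HasLogMoment μ)
    (h' : HasLogMoment ν) :
    Integrable (fun p : ℝ × ℝ => Real.log (1 + |p.1|) + Real.log (1 + |p.2|)) (μ.prod ν) := by
  have := h.isProbabilityMeasure
  have := h'.isProbabilityMeasure
  exact (h.integrable.comp_fst ν).add (h'.integrable.comp_snd μ)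

theorem integrable_log_abs_sub {μ : Measure ℝ} (h : HasLogMoment μ) (hb : HasBoundedDensity μ)
    (x : ℝ) : Integrable (fun y => Real.log |x - y|) μ := by
  have := h.isProbabilityMeasure
  obtain ⟨C, -, hC⟩ := hb.exists_integral_rpow_le
  refine ((h.integrable_log_sub x).add ((hC x).1.const_mul 2)).mono'
    (Measurable.aestronglyMeasurable (by fun_prop))
    (ae_of_all _ fun y => ?_)
  exact abs_log_abs_le (x - y)

/-- Only `ν` needs a bounded density: the singular part is integrated in the second variable first,
with a bound uniform in the first. This permits use for an equilibrium measure whose density is not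
yet known to be bounded. -/
theorem integrable_log_abs_prod {μ ν : Measure ℝ} (h : HasLogMoment μ) (h' : HasLogMoment ν)
    (hb : HasBoundedDensity ν) :
    Integrable (fun p : ℝ × ℝ => Real.log |p.1 - p.2|) (μ.prod ν) := by
  have := h.isProbabilityMeasure
  have := h'.isProbabilityMeasure
  obtain ⟨C, hC0, hC⟩ := hb.exists_integral_rpow_le
  have hk : Integrable (fun p : ℝ × ℝ => |p.1 - p.2| ^ (-(1 / 2) : ℝ)) (μ.prod ν) := by
    rw [integrable_prod_iff (Measurable.aestronglyMeasurable (by fun_prop))]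
    refine ⟨ae_of_all _ fun x => (hC x).1, ?_⟩
    refine (integrable_const C).mono' ?_ (ae_of_all _ fun x => ?_)
    · exact (Measurable.aestronglyMeasurable (by fun_prop)).norm.integral_prod_right'
        (f := fun p : ℝ × ℝ => ‖|p.1 - p.2| ^ (-(1 / 2) : ℝ)‖)
    · rw [Real.norm_of_nonneg (integral_nonneg fun y => norm_nonneg _)]
      refine le_trans (le_of_eq ?_) (hC x).2
      refine integral_congr_ae (ae_of_all _ fun y => ?_)
      exact Real.norm_of_nonneg (by positivity)
  refine ((h.integrable_log_prod h').add (hk.const_mul 2)).mono'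
    (Measurable.aestronglyMeasurable (by fun_prop))
    (ae_of_all _ fun p => ?_)
  refine (abs_log_abs_le (p.1 - p.2)).trans ?_
  have := log_one_add_abs_sub_le p.1 p.2
  simp only [Pi.add_apply]
  linarith

/-- By Fubini some `x` has `log|x - y|` integrable in `y`, and for this `x` one has `1 + |y| ≤ (2 +
|x|) max(1, |x - y|)`. -/
theorem hasLogMoment_of_integrable_prod {μ : Measure ℝ} [IsProbabilityMeasure μ]
    (h : Integrable (fun p : ℝ × ℝ => Real.log |p.1 - p.2|) (μ.prod μ)) : HasLogMoment μ := by
  refine ⟨inferInstance, ?_⟩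
  obtain ⟨x, hx⟩ := h.prod_right_ae.exists
  refine ((integrable_const (Real.log (2 + |x|))).add hx.norm).mono'
    (Measurable.aestronglyMeasurable (by fun_prop))
    (ae_of_all _ fun y => ?_)
  rw [Real.norm_of_nonneg (log_one_add_abs_nonneg _), Pi.add_apply, Real.norm_eq_abs]
  have h0 := abs_nonneg x
  have hy : |y| ≤ |x| + |x - y| := by
    have := abs_sub_abs_le_abs_sub y x
    rw [abs_sub_comm] at this
    linarith
  rcases le_total |x - y| 1 with h1 | h1
  · have : Real.log (1 + |y|) ≤ Real.log (2 + |x|) :=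
      Real.log_le_log (by positivity) (by linarith)
    linarith [abs_nonneg (Real.log |x - y|)]
  · have : Real.log (1 + |y|) ≤ Real.log ((2 + |x|) * |x - y|) :=
      Real.log_le_log (by positivity) (by nlinarith)
    rw [Real.log_mul (by positivity) (by positivity)] at this
    linarith [le_abs_self (Real.log |x - y|)]

theorem integrable_regLog {μ : Measure ℝ} (h : HasLogMoment μ) {ε : ℝ} (hε : 0 < ε) (x : ℝ) :
    Integrable (fun y => regLog ε (x - y)) μ := by
  have := h.isProbabilityMeasure
  refine ((h.integrable_log_sub x).add (integrable_const _)).mono'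
    ((measurable_regLog ε).comp (by fun_prop)).aestronglyMeasurable
    (ae_of_all _ fun y => abs_regLog_le hε (x - y))

theorem integrable_regLog_prod {μ ν : Measure ℝ} (h : HasLogMoment μ) (h' : HasLogMoment ν)
    {ε : ℝ} (hε : 0 < ε) :
    Integrable (fun p : ℝ × ℝ => regLog ε (p.1 - p.2)) (μ.prod ν) := by
  have := h.isProbabilityMeasure
  have := h'.isProbabilityMeasure
  refine ((h.integrable_log_prod h').add
    (integrable_const (|Real.log ε| + Real.log (1 + ε)))).mono'
    ((measurable_regLog ε).comp (by fun_prop)).aestronglyMeasurable (ae_of_all _ fun p => ?_)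
  refine (abs_regLog_le hε (p.1 - p.2)).trans ?_
  have := log_one_add_abs_sub_le p.1 p.2
  simp only [Pi.add_apply]
  linarith

/-- The logarithmic potential of a measure. -/
def logPotential (μ : Measure ℝ) (x : ℝ) : ℝ := ∫ y, Real.log |x - y| ∂μ

theorem measurable_logPotential (μ : Measure ℝ) [SFinite μ] : Measurable (logPotential μ) :=
  (StronglyMeasurable.integral_prod_right' (f := fun p : ℝ × ℝ => Real.log |p.1 - p.2|)
    (by fun_prop : Measurable fun p : ℝ × ℝ => Real.log |p.1 - p.2|).stronglyMeasurable).measurable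

theorem HasLogMoment.exists_logPotential_le {μ : Measure ℝ} (h : HasLogMoment μ) :
    ∃ C : ℝ, 0 ≤ C ∧ ∀ x, logPotential μ x ≤ Real.log (1 + |x|) + C := by
  have := h.isProbabilityMeasure
  refine ⟨∫ y, Real.log (1 + |y|) ∂μ, integral_nonneg fun y => log_one_add_abs_nonneg y,
    fun x => ?_⟩
  have h0 : 0 ≤ ∫ y, Real.log (1 + |y|) ∂μ := integral_nonneg fun y => log_one_add_abs_nonneg y
  by_cases hi : Integrable (fun y => Real.log |x - y|) μ
  · calc logPotential μ x ≤ ∫ y, (Real.log (1 + |x|) + Real.log (1 + |y|)) ∂μ :=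
          integral_mono hi ((integrable_const _).add h.integrable) fun y =>
            (log_abs_le (x - y)).trans (log_one_add_abs_sub_le x y)
      _ = _ := by
          rw [integral_add (integrable_const _) h.integrable]
          simp
  -- Where the logarithm is not integrable, the potential takes the default value `0`, which still
  -- satisfies the bound.
  · rw [logPotential, integral_undef hi]
    linarith [log_one_add_abs_nonneg x]

/-- The error must be uniform in `x`, since the bound is later evaluated at the particles. -/
theorem exists_integral_regLog_le {μ : Measure ℝ} (h : HasLogMoment μ)
    (hb : HasBoundedDensity μ) :
    ∃ C : ℝ, 0 ≤ C ∧ ∀ ε : ℝ, 0 < ε → ∀ x : ℝ,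
      ∫ y, regLog ε (x - y) ∂μ ≤ logPotential μ x + C * √ε := by
  have := h.isProbabilityMeasure
  have := hb.nullSingletonClass
  obtain ⟨C, hC0, hC⟩ := hb.exists_integral_rpow_le
  refine ⟨2 * C, by positivity, fun ε hε x => ?_⟩
  have hi := integrable_log_abs_sub h hb x
  have hne : ∀ᵐ y ∂μ, x - y ≠ 0 := by
    have : ∀ᵐ y ∂μ, y ≠ x := by
      simp [ae_iff, NullSingletonClass.measure_singleton]
    filter_upwards [this] with y hy
    exact sub_ne_zero.mpr hy.symm
  calc ∫ y, regLog ε (x - y) ∂μ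
      ≤ ∫ y, (Real.log |x - y| + 2 * √ε * |x - y| ^ (-(1 / 2) : ℝ)) ∂μ :=
        integral_mono_ae (integrable_regLog h hε x) (hi.add ((hC x).1.const_mul _))
          (hne.mono fun y hy => regLog_le hε hy)
    _ = logPotential μ x + 2 * √ε * ∫ y, |x - y| ^ (-(1 / 2) : ℝ) ∂μ := by
        rw [integral_add hi ((hC x).1.const_mul _), integral_const_mul, logPotential]
    _ ≤ _ := by
        have := mul_le_mul_of_nonneg_left (hC x).2 (show 0 ≤ 2 * √ε by positivity)
        linarith

/-! ### Decay of the potential and Gibbs measures -/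

theorem exists_exp_neg_add_le {V : ℝ → ℝ} (hV : Continuous V)
    (hdec : ∀ α : ℝ, 0 < α → (fun x => Real.exp (-V x)) =o[cocompact ℝ] fun x => |x| ^ (-α))
    (a : ℝ) : ∃ C : ℝ, ∀ x, Real.exp (-V x + a * Real.log (1 + |x|)) ≤ C := by
  -- The decay hypothesis requires a positive exponent; enlarging `a` only increases the left side
  -- because `log(1 + |x|) ≥ 0`.
  set b := max a 1 with hb
  have hb0 : 0 < b := lt_max_of_lt_right one_pos
  have hcont : Continuous fun x : ℝ => Real.exp (-V x + b * Real.log (1 + |x|)) := by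
    have : Continuous fun x : ℝ => Real.log (1 + |x|) :=
      Continuous.log (by fun_prop) fun x => by positivity
    fun_prop
  have hev : ∀ᶠ x in cocompact ℝ, Real.exp (-V x + b * Real.log (1 + |x|)) ≤ (2 : ℝ) ^ b := by
    have h1 : ∀ᶠ x : ℝ in cocompact ℝ, 1 ≤ |x| :=
      (tendsto_norm_cocompact_atTop (E := ℝ)).eventually_ge_atTop 1
    filter_upwards [(hdec b hb0).bound one_pos, h1] with x hx hx1
    have hx0 : 0 < |x| := by linarith
    rw [one_mul, Real.norm_of_nonneg (Real.exp_nonneg _),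
      Real.norm_of_nonneg (by positivity)] at hx
    have h2 : Real.exp (b * Real.log (1 + |x|)) ≤ (2 * |x|) ^ b := by
      rw [mul_comm, ← Real.rpow_def_of_pos (by positivity)]
      exact Real.rpow_le_rpow (by positivity) (by linarith) hb0.le
    calc Real.exp (-V x + b * Real.log (1 + |x|))
        = Real.exp (-V x) * Real.exp (b * Real.log (1 + |x|)) := Real.exp_add _ _
      _ ≤ |x| ^ (-b) * (2 * |x|) ^ b := by gcongr
      _ = 2 ^ b := by
          rw [Real.mul_rpow (by norm_num) hx0.le, Real.rpow_neg hx0.le]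
          have : |x| ^ b ≠ 0 := (Real.rpow_pos_of_pos hx0 b).ne'
          field_simp
  obtain ⟨K, hK, hKs⟩ := (hasBasis_cocompact (X := ℝ)).eventually_iff.mp hev
  obtain ⟨C, hC⟩ := hK.exists_bound_of_continuousOn hcont.continuousOn
  refine ⟨max C (2 ^ b), fun x => ?_⟩
  have hle : Real.exp (-V x + a * Real.log (1 + |x|)) ≤
      Real.exp (-V x + b * Real.log (1 + |x|)) := by
    gcongr
    · exact log_one_add_abs_nonneg x
    · exact le_max_left _ _
  refine hle.trans ?_
  by_cases hx : x ∈ K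
  · exact le_max_of_le_left ((le_abs_self _).trans (hC x hx))
  · exact le_max_of_le_right (hKs hx)

/-- The measure with density `exp (-V + u - ℓ)`. -/
def gibbs (V u : ℝ → ℝ) (ℓ : ℝ) : Measure ℝ :=
  volume.withDensity fun x => ENNReal.ofReal (Real.exp (-V x + u x - ℓ))

theorem measurable_gibbs_density {V u : ℝ → ℝ} (hV : Measurable V) (hu : Measurable u) (ℓ : ℝ) :
    Measurable fun x => ENNReal.ofReal (Real.exp (-V x + u x - ℓ)) := by
  fun_prop

theorem gibbs_absolutelyContinuous (V u : ℝ → ℝ) (ℓ : ℝ) : gibbs V u ℓ ≪ volume :=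
  withDensity_absolutelyContinuous _ _

theorem absolutelyContinuous_gibbs {V u : ℝ → ℝ} (hV : Measurable V) (hu : Measurable u)
    (ℓ : ℝ) : volume ≪ gibbs V u ℓ := by
  refine withDensity_absolutelyContinuous' (measurable_gibbs_density hV hu ℓ).aemeasurable
    (ae_of_all _ fun x => ?_)
  simpa using Real.exp_pos _

theorem density_gibbs {V u : ℝ → ℝ} (hV : Measurable V) (hu : Measurable u) (ℓ : ℝ) :
    density (gibbs V u ℓ) =ᵐ[volume] fun x => Real.exp (-V x + u x - ℓ) := by
  have h := Measure.rnDeriv_withDensity volume (measurable_gibbs_density hV hu ℓ)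
  filter_upwards [h] with x hx
  rw [density, gibbs, hx, ENNReal.toReal_ofReal (Real.exp_nonneg _)]

theorem integrable_gibbs_iff {V u : ℝ → ℝ} (hV : Measurable V) (hu : Measurable u) (ℓ : ℝ)
    (f : ℝ → ℝ) :
    Integrable f (gibbs V u ℓ) ↔ Integrable (fun x => Real.exp (-V x + u x - ℓ) * f x) := by
  rw [gibbs, integrable_withDensity_iff_integrable_smul' (measurable_gibbs_density hV hu ℓ)
    (ae_of_all _ fun x => ENNReal.ofReal_lt_top)]
  simp [ENNReal.toReal_ofReal (Real.exp_nonneg _)]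

theorem integrable_one_add_abs_rpow : Integrable fun x : ℝ => (1 + |x|) ^ (-2 : ℝ) :=
  integrable_one_add_norm (E := ℝ) (r := 2) (by simp)

theorem exists_exp_le_rpow {V u : ℝ → ℝ}
    (hdec : ∀ a : ℝ, ∃ C : ℝ, ∀ x, Real.exp (-V x + a * Real.log (1 + |x|)) ≤ C)
    (hub : ∃ b c : ℝ, ∀ x, u x ≤ b * Real.log (1 + |x|) + c) (k : ℝ) :
    ∃ C : ℝ, 0 ≤ C ∧ ∀ x, Real.exp (-V x + u x) ≤ C * (1 + |x|) ^ (-k) := by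
  obtain ⟨b, c, hbc⟩ := hub
  obtain ⟨C, hC⟩ := hdec (b + k)
  have hC0 : 0 ≤ C := (Real.exp_nonneg _).trans (hC 0)
  refine ⟨C * Real.exp c, by positivity, fun x => ?_⟩
  have hx : (0 : ℝ) < 1 + |x| := by positivity
  calc Real.exp (-V x + u x)
      ≤ Real.exp ((-V x + (b + k) * Real.log (1 + |x|)) + c + Real.log (1 + |x|) * (-k)) := by
        refine Real.exp_le_exp.mpr ?_
        linarith [hbc x]
    _ = Real.exp (-V x + (b + k) * Real.log (1 + |x|)) * Real.exp c * (1 + |x|) ^ (-k) := by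
        rw [Real.exp_add, Real.exp_add, Real.rpow_def_of_pos hx]
    _ ≤ C * Real.exp c * (1 + |x|) ^ (-k) := by
        gcongr
        exact hC x

theorem integrable_exp_neg_add {V u : ℝ → ℝ} (hV : Measurable V) (hu : Measurable u)
    (hdec : ∀ a : ℝ, ∃ C : ℝ, ∀ x, Real.exp (-V x + a * Real.log (1 + |x|)) ≤ C)
    (hub : ∃ b c : ℝ, ∀ x, u x ≤ b * Real.log (1 + |x|) + c) :
    Integrable fun x => Real.exp (-V x + u x) := by
  obtain ⟨C, -, hC⟩ := exists_exp_le_rpow hdec hub 2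
  refine (integrable_one_add_abs_rpow.const_mul C).mono'
    (Measurable.aestronglyMeasurable (by fun_prop)) (ae_of_all _ fun x => ?_)
  rw [Real.norm_of_nonneg (Real.exp_nonneg _)]
  exact hC x

theorem hasBoundedDensity_gibbs {V u : ℝ → ℝ}
    (hdec : ∀ a : ℝ, ∃ C : ℝ, ∀ x, Real.exp (-V x + a * Real.log (1 + |x|)) ≤ C)
    (hub : ∃ b c : ℝ, ∀ x, u x ≤ b * Real.log (1 + |x|) + c) (ℓ : ℝ) :
    HasBoundedDensity (gibbs V u ℓ) := by
  obtain ⟨C, -, hC⟩ := exists_exp_le_rpow hdec hub 0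
  refine ⟨ENNReal.ofReal (C * Real.exp (-ℓ)), ENNReal.ofReal_ne_top, ?_⟩
  rw [← withDensity_const, gibbs]
  refine withDensity_mono (ae_of_all _ fun x => ENNReal.ofReal_le_ofReal ?_)
  rw [sub_eq_add_neg, Real.exp_add]
  gcongr
  simpa using hC x

theorem exists_gibbs_hasLogMoment {V u : ℝ → ℝ} (hV : Measurable V) (hu : Measurable u)
    (hdec : ∀ a : ℝ, ∃ C : ℝ, ∀ x, Real.exp (-V x + a * Real.log (1 + |x|)) ≤ C)
    (hub : ∃ b c : ℝ, ∀ x, u x ≤ b * Real.log (1 + |x|) + c) :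
    ∃ ℓ : ℝ, HasLogMoment (gibbs V u ℓ) := by
  have hi := integrable_exp_neg_add hV hu hdec hub
  have hpos : 0 < ∫ x, Real.exp (-V x + u x) := integral_exp_pos hi
  set ℓ := Real.log (∫ x, Real.exp (-V x + u x)) with hℓ
  have hexp : ∀ x, Real.exp (-V x + u x - ℓ) =
      Real.exp (-V x + u x) * (∫ x, Real.exp (-V x + u x))⁻¹ := fun x => by
    rw [Real.exp_sub, hℓ, Real.exp_log hpos, div_eq_mul_inv]
  refine ⟨ℓ, ⟨⟨?_⟩, ?_⟩⟩
  · rw [gibbs, withDensity_apply _ MeasurableSet.univ, setLIntegral_univ,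
      ← ofReal_integral_eq_lintegral_ofReal _ (ae_of_all _ fun x => Real.exp_nonneg _)]
    · simp_rw [hexp]
      rw [integral_mul_const, mul_inv_cancel₀ hpos.ne', ENNReal.ofReal_one]
    · simp_rw [hexp]
      exact hi.mul_const _
  · rw [integrable_gibbs_iff hV hu]
    -- Two powers give integrability; the third absorbs `log(1 + |x|) ≤ 1 + |x|`.
    obtain ⟨C, hC0, hC⟩ := exists_exp_le_rpow hdec hub 3
    refine (integrable_one_add_abs_rpow.const_mul (C * Real.exp (-ℓ))).mono'
      (Measurable.aestronglyMeasurable (by fun_prop)) (ae_of_all _ fun x => ?_)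
    have hx : (0 : ℝ) < 1 + |x| := by positivity
    rw [Real.norm_of_nonneg (mul_nonneg (Real.exp_nonneg _) (log_one_add_abs_nonneg x))]
    calc Real.exp (-V x + u x - ℓ) * Real.log (1 + |x|)
        ≤ (C * (1 + |x|) ^ (-3 : ℝ) * Real.exp (-ℓ)) * (1 + |x|) := by
          rw [sub_eq_add_neg, Real.exp_add]
          have h0 := log_one_add_abs_nonneg x
          have h1 : Real.log (1 + |x|) ≤ 1 + |x| := by
            linarith [Real.log_le_sub_one_of_pos hx]
          have h2 := hC x
          gcongr
      _ = C * Real.exp (-ℓ) * ((1 + |x|) ^ (-3 : ℝ) * (1 + |x|) ^ (1 : ℝ)) := by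
          rw [Real.rpow_one]; ring
      _ = C * Real.exp (-ℓ) * (1 + |x|) ^ (-2 : ℝ) := by
          rw [← Real.rpow_add hx]; norm_num

/-! ### Free energy -/

/-- The integrability part of the definition of the energy. -/
structure HasFiniteEnergy (V : ℝ → ℝ) (μ : Measure ℝ) : Prop where
  absolutelyContinuous : μ ≪ volume
  integrable_entropy : Integrable (fun x => V x + Real.log (density μ x)) μ
  integrable_log : Integrable (fun p : ℝ × ℝ => Real.log |p.1 - p.2|) (μ.prod μ)

/-- The potential and entropy part of the energy. -/
def entropyEnergy (V : ℝ → ℝ) (μ : Measure ℝ) : ℝ := ∫ x, (V x + Real.log (density μ x)) ∂μ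

/-- The mutual logarithmic energy of two measures. -/
def logEnergy (μ ν : Measure ℝ) : ℝ := ∫ p : ℝ × ℝ, Real.log |p.1 - p.2| ∂(μ.prod ν)

theorem HasFiniteEnergy.energy_eq {V : ℝ → ℝ} {μ : Measure ℝ} (h : HasFiniteEnergy V μ) (P : ℝ) :
    energy V P μ = ((entropyEnergy V μ - P * logEnergy μ μ : ℝ) : EReal) := by
  rw [energy, if_pos ⟨h.1, h.2, h.3⟩, entropyEnergy, logEnergy]

theorem hasFiniteEnergy_of_energy_ne_top {V : ℝ → ℝ} {P : ℝ} {μ : Measure ℝ}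
    (h : energy V P μ ≠ ⊤) : HasFiniteEnergy V μ := by
  rw [energy] at h
  by_contra hc
  exact h (if_neg fun h' => hc ⟨h'.1, h'.2.1, h'.2.2⟩)

theorem gibbs_entropy_ae {V u : ℝ → ℝ} (hV : Measurable V) (hu : Measurable u) (ℓ : ℝ) :
    (fun x => V x + Real.log (density (gibbs V u ℓ) x)) =ᵐ[gibbs V u ℓ] fun x => u x - ℓ := by
  filter_upwards [(gibbs_absolutelyContinuous V u ℓ).ae_eq (density_gibbs hV hu ℓ)] with x hx
  rw [hx, Real.log_exp]
  ring

theorem hasFiniteEnergy_gibbs {V u : ℝ → ℝ} (hV : Measurable V) (hu : Measurable u)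
    (hdec : ∀ a : ℝ, ∃ C : ℝ, ∀ x, Real.exp (-V x + a * Real.log (1 + |x|)) ≤ C)
    (hub : ∃ b c : ℝ, ∀ x, u x ≤ b * Real.log (1 + |x|) + c) {ℓ : ℝ}
    (hℓ : HasLogMoment (gibbs V u ℓ)) (hui : Integrable u (gibbs V u ℓ)) :
    HasFiniteEnergy V (gibbs V u ℓ) := by
  have := hℓ.isProbabilityMeasure
  refine ⟨gibbs_absolutelyContinuous V u ℓ, ?_,
    integrable_log_abs_prod hℓ hℓ (hasBoundedDensity_gibbs hdec hub ℓ)⟩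
  rw [integrable_congr (gibbs_entropy_ae hV hu ℓ)]
  exact hui.sub (integrable_const ℓ)

theorem entropyEnergy_gibbs {V u : ℝ → ℝ} (hV : Measurable V) (hu : Measurable u) {ℓ : ℝ}
    (hℓ : HasLogMoment (gibbs V u ℓ)) (hui : Integrable u (gibbs V u ℓ)) :
    entropyEnergy V (gibbs V u ℓ) = ∫ x, u x ∂(gibbs V u ℓ) - ℓ := by
  have := hℓ.isProbabilityMeasure
  rw [entropyEnergy, integral_congr_ae (gibbs_entropy_ae hV hu ℓ),
    integral_sub hui (integrable_const ℓ)]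
  simp

/-- The segment between two measures. -/
def mixture (t : ℝ) (μ ν : Measure ℝ) : Measure ℝ :=
  ENNReal.ofReal (1 - t) • μ + ENNReal.ofReal t • ν

theorem isProbabilityMeasure_mixture {t : ℝ} (ht : t ∈ Set.Icc (0 : ℝ) 1) (μ ν : Measure ℝ)
    [IsProbabilityMeasure μ] [IsProbabilityMeasure ν] : IsProbabilityMeasure (mixture t μ ν) := by
  constructor
  rw [mixture, Measure.add_apply, Measure.smul_apply, Measure.smul_apply, measure_univ,
    measure_univ, smul_eq_mul, smul_eq_mul, mul_one, mul_one,
    ← ENNReal.ofReal_add (by linarith [ht.2]) ht.1]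
  simp

theorem density_mixture {t : ℝ} (ht : t ∈ Set.Icc (0 : ℝ) 1) (μ ν : Measure ℝ)
    [IsProbabilityMeasure μ] [IsProbabilityMeasure ν] :
    density (mixture t μ ν) =ᵐ[volume] fun x => (1 - t) * density μ x + t * density ν x := by
  have f1 := μ.smul_finite (ENNReal.ofReal_ne_top (r := 1 - t))
  have f2 := ν.smul_finite (ENNReal.ofReal_ne_top (r := t))
  have h1 := Measure.rnDeriv_add (ENNReal.ofReal (1 - t) • μ) (ENNReal.ofReal t • ν)
    (volume : Measure ℝ)
  have h2 := Measure.rnDeriv_smul_left_of_ne_top μ (volume : Measure ℝ)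
    (ENNReal.ofReal_ne_top (r := 1 - t))
  have h3 := Measure.rnDeriv_smul_left_of_ne_top ν (volume : Measure ℝ)
    (ENNReal.ofReal_ne_top (r := t))
  filter_upwards [h1, h2, h3, μ.rnDeriv_lt_top volume, ν.rnDeriv_lt_top volume]
    with x h1 h2 h3 h4 h5
  rw [density, mixture, h1, Pi.add_apply, h2, h3, Pi.smul_apply, Pi.smul_apply, smul_eq_mul,
    smul_eq_mul, ENNReal.toReal_add (by finiteness) (by finiteness), ENNReal.toReal_mul,
    ENNReal.toReal_mul, ENNReal.toReal_ofReal (by linarith [ht.2]), ENNReal.toReal_ofReal ht.1,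
    density, density]

theorem mixture_absolutelyContinuous (t : ℝ) {μ ν : Measure ℝ} (hμ : μ ≪ volume)
    (hν : ν ≪ volume) : mixture t μ ν ≪ volume := by
  intro s hs
  simp [mixture, hμ hs, hν hs]

theorem integrable_density_mul_iff {μ : Measure ℝ} [IsProbabilityMeasure μ] (h : μ ≪ volume)
    (f : ℝ → ℝ) : Integrable (fun x => density μ x * f x) ↔ Integrable f μ :=
  integrable_rnDeriv_smul_iff h

theorem integral_density_mul {μ : Measure ℝ} [IsProbabilityMeasure μ] (h : μ ≪ volume)
    (f : ℝ → ℝ) : ∫ x, density μ x * f x = ∫ x, f x ∂μ :=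
  integral_rnDeriv_smul h

theorem measurable_density (μ : Measure ℝ) : Measurable (density μ) :=
  (Measure.measurable_rnDeriv μ volume).ennreal_toReal

/-- This is `log s ≥ 1 - 1/s` at `s = r e^v`. It supplies an integrable lower bound for entropy
integrands. -/
theorem neg_exp_neg_le_mul_add_log {v r : ℝ} (hr : 0 ≤ r) :
    -Real.exp (-v) ≤ r * (v + Real.log r) := by
  rcases hr.eq_or_lt with rfl | hr
  · simpa using Real.exp_nonneg _
  · have hs : 0 < r * Real.exp v := by positivity
    have h1 : Real.log (r * Real.exp v) = Real.log r + v := by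
      rw [Real.log_mul hr.ne' (Real.exp_ne_zero _), Real.log_exp]
    have h2 := Real.one_sub_inv_le_log_of_pos hs
    rw [h1] at h2
    have h3 := mul_le_mul_of_nonneg_left h2 hr.le
    have h4 : r * (1 - (r * Real.exp v)⁻¹) = r - Real.exp (-v) := by
      rw [Real.exp_neg]
      field_simp
    rw [h4] at h3
    linarith

/-- Convexity of `r ↦ r log r`, applied pointwise to the densities, bounds the integrand above;
`-e^{-V}` bounds it below. The two bounds together give integrability. -/
theorem mixture_entropy {V : ℝ → ℝ} (hV : Measurable V)
    (hVi : Integrable fun x => Real.exp (-V x)) {μ ν : Measure ℝ} [IsProbabilityMeasure μ]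
    [IsProbabilityMeasure ν] (hμ : HasFiniteEnergy V μ) (hν : HasFiniteEnergy V ν) {t : ℝ}
    (ht : t ∈ Set.Icc (0 : ℝ) 1) :
    Integrable (fun x => V x + Real.log (density (mixture t μ ν) x)) (mixture t μ ν) ∧
      entropyEnergy V (mixture t μ ν) ≤
        (1 - t) * entropyEnergy V μ + t * entropyEnergy V ν := by
  have := isProbabilityMeasure_mixture ht μ ν
  have hac := mixture_absolutelyContinuous t hμ.1 hν.1
  have hi1 := (integrable_density_mul_iff hμ.1 _).mpr hμ.2
  have hi2 := (integrable_density_mul_iff hν.1 _).mpr hν.2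
  have hup := (hi1.const_mul (1 - t)).add (hi2.const_mul t)
  have hle : ∀ᵐ x : ℝ, density (mixture t μ ν) x *
      (V x + Real.log (density (mixture t μ ν) x)) ≤
      (1 - t) * (density μ x * (V x + Real.log (density μ x))) +
        t * (density ν x * (V x + Real.log (density ν x))) := by
    filter_upwards [density_mixture ht μ ν] with x hx
    have hc := Real.convexOn_mul_log.2
      (show density μ x ∈ Set.Ici 0 from ENNReal.toReal_nonneg)
      (show density ν x ∈ Set.Ici 0 from ENNReal.toReal_nonneg)
      (show 0 ≤ 1 - t by linarith [ht.2]) ht.1 (by ring)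
    simp only [smul_eq_mul] at hc
    rw [hx]
    nlinarith [hc]
  have hmeas : Measurable fun x => density (mixture t μ ν) x *
      (V x + Real.log (density (mixture t μ ν) x)) := by
    have := measurable_density (mixture t μ ν)
    fun_prop
  have hint : Integrable fun x => density (mixture t μ ν) x *
      (V x + Real.log (density (mixture t μ ν) x)) := by
    refine integrable_of_le_of_le hmeas.aestronglyMeasurable
      (ae_of_all _ fun x => neg_exp_neg_le_mul_add_log ENNReal.toReal_nonneg) hle hVi.neg hup
  refine ⟨(integrable_density_mul_iff hac _).mp hint, ?_⟩
  calc entropyEnergy V (mixture t μ ν)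
      = ∫ x, density (mixture t μ ν) x * (V x + Real.log (density (mixture t μ ν) x)) :=
        (integral_density_mul hac _).symm
    _ ≤ ∫ x, ((1 - t) * (density μ x * (V x + Real.log (density μ x))) +
        t * (density ν x * (V x + Real.log (density ν x)))) := integral_mono_ae hint hup hle
    _ = _ := by
        rw [integral_add (hi1.const_mul _) (hi2.const_mul _), integral_const_mul,
          integral_const_mul, integral_density_mul hμ.1, integral_density_mul hν.1,
          entropyEnergy, entropyEnergy]

theorem mixture_prod (t : ℝ) (μ ν : Measure ℝ) [IsProbabilityMeasure μ]
    [IsProbabilityMeasure ν] :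
    (mixture t μ ν).prod (mixture t μ ν) =
      (ENNReal.ofReal (1 - t) • ENNReal.ofReal (1 - t) • μ.prod μ +
        ENNReal.ofReal (1 - t) • ENNReal.ofReal t • μ.prod ν) +
      (ENNReal.ofReal t • ENNReal.ofReal (1 - t) • ν.prod μ +
        ENNReal.ofReal t • ENNReal.ofReal t • ν.prod ν) := by
  rw [mixture, Measure.prod_add, Measure.add_prod, Measure.add_prod]
  simp only [Measure.prod_smul_left, Measure.prod_smul_right]
  rw [smul_comm (ENNReal.ofReal (1 - t)) (ENNReal.ofReal t) (ν.prod μ),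
    smul_comm (ENNReal.ofReal t) (ENNReal.ofReal (1 - t)) (μ.prod ν)]
  abel

theorem logEnergy_comm (μ ν : Measure ℝ) [SFinite μ] [SFinite ν] :
    logEnergy μ ν = logEnergy ν μ := by
  rw [logEnergy, logEnergy, ← integral_prod_swap]
  refine integral_congr_ae (ae_of_all _ fun p => ?_)
  simp only [Prod.fst_swap, Prod.snd_swap, abs_sub_comm]

theorem integrable_log_abs_prod_swap {μ ν : Measure ℝ} [SFinite μ] [SFinite ν]
    (h : Integrable (fun p : ℝ × ℝ => Real.log |p.1 - p.2|) (μ.prod ν)) :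
    Integrable (fun p : ℝ × ℝ => Real.log |p.1 - p.2|) (ν.prod μ) := by
  refine h.swap.congr (ae_of_all _ fun p => ?_)
  simp only [Function.comp_apply, Prod.fst_swap, Prod.snd_swap, abs_sub_comm]

theorem mixture_logEnergy {μ ν : Measure ℝ} [IsProbabilityMeasure μ] [IsProbabilityMeasure ν]
    (hμ : Integrable (fun p : ℝ × ℝ => Real.log |p.1 - p.2|) (μ.prod μ))
    (hμν : Integrable (fun p : ℝ × ℝ => Real.log |p.1 - p.2|) (μ.prod ν))
    (hν : Integrable (fun p : ℝ × ℝ => Real.log |p.1 - p.2|) (ν.prod ν)) {t : ℝ}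
    (ht : t ∈ Set.Icc (0 : ℝ) 1) :
    Integrable (fun p : ℝ × ℝ => Real.log |p.1 - p.2|)
        ((mixture t μ ν).prod (mixture t μ ν)) ∧
      logEnergy (mixture t μ ν) (mixture t μ ν) =
        (1 - t) ^ 2 * logEnergy μ μ + 2 * t * (1 - t) * logEnergy μ ν +
          t ^ 2 * logEnergy ν ν := by
  have hsm : ∀ {σ : Measure (ℝ × ℝ)} (a b : ℝ),
      Integrable (fun p : ℝ × ℝ => Real.log |p.1 - p.2|) σ →
      Integrable (fun p : ℝ × ℝ => Real.log |p.1 - p.2|)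
        (ENNReal.ofReal a • ENNReal.ofReal b • σ) := fun a b h =>
    (h.smul_measure ENNReal.ofReal_ne_top).smul_measure ENNReal.ofReal_ne_top
  have hνμ := integrable_log_abs_prod_swap hμν
  have h1 := hsm (1 - t) (1 - t) hμ
  have h2 := hsm (1 - t) t hμν
  have h3 := hsm t (1 - t) hνμ
  have h4 := hsm t t hν
  have h12 := h1.add_measure h2
  have h34 := h3.add_measure h4
  constructor
  · rw [mixture_prod]
    exact h12.add_measure h34
  · rw [logEnergy, mixture_prod, integral_add_measure h12 h34, integral_add_measure h1 h2,
      integral_add_measure h3 h4]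
    simp only [integral_smul_measure]
    rw [ENNReal.toReal_ofReal (by linarith [ht.2]), ENNReal.toReal_ofReal ht.1]
    have hc := logEnergy_comm ν μ
    rw [logEnergy] at hc
    rw [hc]
    simp only [logEnergy, smul_eq_mul]
    ring

/-- Along the segment from `μ` to `ν` the energy increases by at most `t (a + t b)`: the entropy is
convex and the logarithmic energy is exactly quadratic. Minimality, division by `t` and `t → 0` give
`a ≥ 0`; no sign of `b` is needed. -/
theorem first_variation {V : ℝ → ℝ} (hV : Measurable V)
    (hVi : Integrable fun x => Real.exp (-V x)) {P : ℝ} {μ ν : Measure ℝ}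
    (h : IsEquilibriumMeasure V P μ) [IsProbabilityMeasure ν]
    (hμ : HasFiniteEnergy V μ) (hν : HasFiniteEnergy V ν)
    (hμν : Integrable (fun p : ℝ × ℝ => Real.log |p.1 - p.2|) (μ.prod ν)) :
    entropyEnergy V μ - 2 * P * logEnergy μ μ ≤ entropyEnergy V ν - 2 * P * logEnergy μ ν := by
  have := h.isProbabilityMeasure
  set a := entropyEnergy V ν - 2 * P * logEnergy μ ν -
    (entropyEnergy V μ - 2 * P * logEnergy μ μ) with ha
  set b := -P * (logEnergy μ μ - 2 * logEnergy μ ν + logEnergy ν ν) with hb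
  have key : ∀ t ∈ Set.Ioc (0 : ℝ) 1, 0 ≤ a + t * b := by
    intro t ht
    have ht' : t ∈ Set.Icc (0 : ℝ) 1 := ⟨ht.1.le, ht.2⟩
    obtain ⟨e1, e2⟩ := mixture_entropy hV hVi hμ hν ht'
    obtain ⟨l1, l2⟩ := mixture_logEnergy hμ.3 hμν hν.3 ht'
    have hf : HasFiniteEnergy V (mixture t μ ν) :=
      ⟨mixture_absolutelyContinuous t hμ.1 hν.1, e1, l1⟩
    have hle := h.energy_le (mixture t μ ν) (isProbabilityMeasure_mixture ht' μ ν)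
    rw [hμ.energy_eq, hf.energy_eq, EReal.coe_le_coe_iff, l2] at hle
    have h0 : 0 ≤ t * (a + t * b) := by
      rw [ha, hb]
      nlinarith [hle, e2]
    exact nonneg_of_mul_nonneg_right h0 ht.1
  have hlim : Tendsto (fun t : ℝ => a + t * b) (𝓝[>] 0) (𝓝 (a + 0 * b)) :=
    ((continuous_const.add (continuous_id.mul continuous_const)).tendsto 0).mono_left
      nhdsWithin_le_nhds
  have h0 : 0 ≤ a + 0 * b := by
    refine ge_of_tendsto hlim ?_
    filter_upwards [Ioc_mem_nhdsGT (zero_lt_one' ℝ)] with t ht using key t ht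
  linarith

/-- The Euler-Lagrange equation for the equilibrium measure. -/
theorem equilibrium_eq_gibbs {V : ℝ → ℝ} (hV : Measurable V)
    (hdec : ∀ a : ℝ, ∃ C : ℝ, ∀ x, Real.exp (-V x + a * Real.log (1 + |x|)) ≤ C) {P : ℝ}
    (hP : 0 < P) {μ : Measure ℝ} (h : IsEquilibriumMeasure V P μ) :
    HasLogMoment μ ∧ HasBoundedDensity μ ∧
      ∃ ℓ : ℝ, μ = gibbs V (fun x => 2 * P * logPotential μ x) ℓ := by
  have := h.isProbabilityMeasure
  have h0b : ∃ b c : ℝ, ∀ x : ℝ, (fun _ : ℝ => (0 : ℝ)) x ≤ b * Real.log (1 + |x|) + c :=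
    ⟨0, 0, fun x => by simp⟩
  have hVi : Integrable fun x => Real.exp (-V x) := by
    simpa using integrable_exp_neg_add hV measurable_const hdec h0b
  -- The normalisation of `e^{-V}` has finite energy, hence so has the minimiser.
  have hμ : HasFiniteEnergy V μ := by
    obtain ⟨ℓ, hℓ⟩ := exists_gibbs_hasLogMoment hV measurable_const hdec h0b
    have hf := hasFiniteEnergy_gibbs hV measurable_const hdec h0b hℓ (integrable_zero _ _ _)
    refine hasFiniteEnergy_of_energy_ne_top (P := P) (ne_top_of_le_ne_top ?_
      (h.energy_le _ hℓ.isProbabilityMeasure))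
    rw [hf.energy_eq]
    exact EReal.coe_ne_top _
  have hlog := hasLogMoment_of_integrable_prod hμ.integrable_log
  set u : ℝ → ℝ := fun x => 2 * P * logPotential μ x with hu
  have hum : Measurable u := (measurable_logPotential μ).const_mul _
  have hub : ∃ b c : ℝ, ∀ x, u x ≤ b * Real.log (1 + |x|) + c := by
    obtain ⟨C, -, hC⟩ := hlog.exists_logPotential_le
    refine ⟨2 * P, 2 * P * C, fun x => ?_⟩
    rw [← mul_add]
    exact mul_le_mul_of_nonneg_left (hC x) (by positivity)
  obtain ⟨ℓ, hℓ⟩ := exists_gibbs_hasLogMoment hV hum hdec hub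
  have hbd := hasBoundedDensity_gibbs hdec hub ℓ
  have := hℓ.isProbabilityMeasure
  have hμν := integrable_log_abs_prod hlog hℓ hbd
  have hνμ := integrable_log_abs_prod_swap hμν
  have hui : Integrable u (gibbs V u ℓ) := hνμ.integral_prod_left.const_mul (2 * P)
  have huμ : Integrable u μ := hμ.integrable_log.integral_prod_left.const_mul (2 * P)
  have hν := hasFiniteEnergy_gibbs hV hum hdec hub hℓ hui
  -- For this competitor the entropy term is `∫ u dν - ℓ`, and `∫ u dν` cancels against the mutual
  -- logarithmic energy. The inequality becomes `entropyEnergy V μ - 2P logEnergy μ μ + ℓ ≤ 0`,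
  -- whose left side is the relative entropy of `μ` with respect to the Gibbs measure.
  have hfv := first_variation hV hVi h hμ hν hμν
  have hJ : ∫ x, u x ∂(gibbs V u ℓ) = 2 * P * logEnergy μ (gibbs V u ℓ) := by
    rw [logEnergy_comm, logEnergy, integral_prod _ hνμ, hu, integral_const_mul]
    rfl
  have hI : ∫ x, u x ∂μ = 2 * P * logEnergy μ μ := by
    rw [logEnergy, integral_prod _ hμ.integrable_log, hu, integral_const_mul]
    rfl
  rw [entropyEnergy_gibbs hV hum hℓ hui, hJ] at hfv
  have hac : μ ≪ gibbs V u ℓ := hμ.1.trans (absolutelyContinuous_gibbs hV hum ℓ)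
  have hllr : llr μ (gibbs V u ℓ) =ᵐ[μ]
      fun x => (V x + Real.log (density μ x)) - u x + ℓ := by
    have h1 := Measure.rnDeriv_withDensity_right μ volume
      (measurable_gibbs_density hV hum ℓ).aemeasurable
      (ae_of_all _ fun x => by simpa using Real.exp_pos _)
      (ae_of_all _ fun x => ENNReal.ofReal_ne_top)
    filter_upwards [hμ.1.ae_eq h1, Measure.rnDeriv_pos hμ.1,
      hμ.1.ae_le (μ.rnDeriv_lt_top volume)] with x hx hpos hlt
    have hd : 0 < density μ x := ENNReal.toReal_pos hpos.ne' hlt.ne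
    rw [density] at hd ⊢
    rw [llr, gibbs, hx, ENNReal.toReal_mul, ENNReal.toReal_inv,
      ENNReal.toReal_ofReal (Real.exp_nonneg _), ← Real.exp_neg,
      Real.log_mul (Real.exp_ne_zero _) hd.ne', Real.log_exp]
    ring
  have hkl : μ = gibbs V u ℓ := by
    rw [← InformationTheory.klDiv_eq_zero_iff]
    have hi : Integrable (fun x => (V x + Real.log (density μ x)) - u x) μ :=
      hμ.integrable_entropy.sub huμ
    have hi' : Integrable (llr μ (gibbs V u ℓ)) μ :=
      (hi.add (integrable_const ℓ)).congr hllr.symm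
    have hne : InformationTheory.klDiv μ (gibbs V u ℓ) ≠ ∞ :=
      InformationTheory.klDiv_ne_top hac hi'
    have heq := InformationTheory.toReal_klDiv_of_measure_eq hac (by simp)
    rw [integral_congr_ae hllr, integral_add hi (integrable_const ℓ),
      integral_sub hμ.integrable_entropy huμ, hI] at heq
    have hEE : ∫ x, (V x + Real.log (density μ x)) ∂μ = entropyEnergy V μ := rfl
    rw [hEE] at heq
    simp only [integral_const, probReal_univ, smul_eq_mul, one_mul] at heq
    have h0 : (InformationTheory.klDiv μ (gibbs V u ℓ)).toReal ≤ 0 := by linarith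
    have h0' := le_antisymm h0 ENNReal.toReal_nonneg
    exact ((ENNReal.toReal_eq_zero_iff _).mp h0').resolve_right hne
  exact ⟨hlog, hkl ▸ hbd, ℓ, hkl⟩

/-! ### Fourier representation of the regularised logarithmic energy -/

theorem integrable_exp_neg_mul_abs {a : ℝ} (ha : 0 < a) :
    Integrable fun t : ℝ => Real.exp (-a * |t|) := by
  rw [← integrableOn_univ, ← Set.Iic_union_Ioi (a := (0 : ℝ)), integrableOn_union]
  constructor
  · refine (integrableOn_exp_mul_Iic ha 0).congr_fun (fun t ht => ?_) measurableSet_Iic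
    simp only [abs_of_nonpos (Set.mem_Iic.mp ht), mul_neg, neg_mul, neg_neg]
  · refine (integrableOn_exp_mul_Ioi (neg_neg_of_pos ha) 0).congr_fun (fun t ht => ?_)
      measurableSet_Ioi
    simp only [abs_of_pos (Set.mem_Ioi.mp ht)]

theorem integral_exp_neg_mul_abs_mul_cos {s : ℝ} (hs : 0 < s) (x : ℝ) :
    ∫ t : ℝ, Real.exp (-s * |t|) * Real.cos (t * x) = 2 * (s / (x ^ 2 + s ^ 2)) := by
  have h1 : ∀ t : ℝ, Real.exp (-s * |t|) * Real.cos (t * x) =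
      (fun r : ℝ => Real.exp (-s * r) * Real.cos (r * x)) |t| := by
    intro t
    rcases abs_cases t with ⟨h, -⟩ | ⟨h, -⟩ <;> simp [h]
  refine (integral_congr_ae (ae_of_all _ h1)).trans ((integral_comp_abs
    (f := fun r : ℝ => Real.exp (-s * r) * Real.cos (r * x))).trans ?_)
  congr 1
  have h2 : ∀ t : ℝ, Real.exp (-s * t) * Real.cos (t * x) =
      (Complex.exp ((-s + x * Complex.I) * t)).re := by
    intro t
    rw [Complex.exp_re]
    simp [mul_comm]
  have hre : (-s + x * Complex.I : ℂ).re < 0 := by simpa using hs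
  simp_rw [h2]
  have h3 := integral_re (𝕜 := ℂ) (integrableOn_exp_mul_complex_Ioi hre 0)
  simp only [RCLike.re_to_complex] at h3
  rw [h3, integral_exp_mul_complex_Ioi hre]
  simp [Complex.div_re, Complex.normSq_apply]
  have : x ^ 2 + s ^ 2 ≠ 0 := by positivity
  field_simp
  ring

/-- The weight `∫_ε^R e^{-s|t|} ds`, i.e. `(e^{-ε|t|} - e^{-R|t|}) / |t|`. -/
def laplaceWeight (ε R t : ℝ) : ℝ := ∫ s in ε..R, Real.exp (-s * |t|)

theorem continuous_laplaceWeight (ε R : ℝ) : Continuous (laplaceWeight ε R) :=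
  intervalIntegral.continuous_parametric_intervalIntegral_of_continuous'
    (f := fun t s : ℝ => Real.exp (-s * |t|)) (by fun_prop) ε R

theorem laplaceWeight_nonneg {ε R : ℝ} (h : ε ≤ R) (t : ℝ) : 0 ≤ laplaceWeight ε R t :=
  intervalIntegral.integral_nonneg h fun _ _ => Real.exp_nonneg _

theorem laplaceWeight_eq (ε R : ℝ) {t : ℝ} (ht : t ≠ 0) :
    laplaceWeight ε R t = (Real.exp (-ε * |t|) - Real.exp (-R * |t|)) / |t| := by
  have ht' : |t| ≠ 0 := abs_ne_zero.mpr ht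
  have hd : ∀ s ∈ Set.uIcc ε R,
      HasDerivAt (fun s => -(Real.exp (-s * |t|) / |t|)) (Real.exp (-s * |t|)) s := by
    intro s _
    have h1 : HasDerivAt (fun s : ℝ => -s * |t|) (-1 * |t|) s :=
      (hasDerivAt_id s).neg.mul_const _
    have h2 := (h1.exp.div_const |t|).neg
    refine h2.congr_deriv ?_
    field_simp
  rw [laplaceWeight, intervalIntegral.integral_eq_sub_of_hasDerivAt hd
    ((by fun_prop : Continuous fun s : ℝ => Real.exp (-s * |t|)).intervalIntegrable _ _)]
  ring

theorem integrable_exp_cos_prod {ε R : ℝ} (hε : 0 < ε) (h : ε ≤ R) (x : ℝ) :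
    Integrable (Function.uncurry fun s t : ℝ => Real.exp (-s * |t|) * Real.cos (t * x))
      ((volume.restrict (Set.uIoc ε R)).prod volume) := by
  have h1 : Integrable (fun p : ℝ × ℝ => (1 : ℝ) * Real.exp (-ε * |p.2|))
      ((volume.restrict (Set.uIoc ε R)).prod volume) := by
    refine Integrable.mul_prod (f := fun _ : ℝ => (1 : ℝ)) ?_ (integrable_exp_neg_mul_abs hε)
    rw [Set.uIoc_of_le h]
    exact integrable_const _
  have hae : ∀ᵐ p ∂((volume.restrict (Set.uIoc ε R)).prod (volume : Measure ℝ)),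
      p.1 ∈ Set.uIoc ε R := by
    refine Measure.quasiMeasurePreserving_fst.ae ?_
    exact ae_restrict_mem measurableSet_uIoc
  refine h1.mono' (Continuous.aestronglyMeasurable (by fun_prop)) ?_
  filter_upwards [hae] with p hp
  rw [Set.uIoc_of_le h] at hp
  simp only [Function.uncurry, norm_mul, Real.norm_eq_abs, Real.abs_exp]
  rw [mul_comm]
  refine mul_le_mul (Real.abs_cos_le_one _) ?_ (Real.exp_nonneg _) zero_le_one
  refine Real.exp_le_exp.mpr ?_
  nlinarith [hp.1, abs_nonneg p.2]

/-- After Fubini the inner integral is `2s/(x² + s²)`, the `s`-derivative of `2 regLog s x`. The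
upper cutoff `R` is needed because `e^{-ε|t|}/|t|` is not integrable at the origin. -/
theorem integral_laplaceWeight_mul_cos {ε R : ℝ} (hε : 0 < ε) (h : ε ≤ R) (x : ℝ) :
    ∫ t, laplaceWeight ε R t * Real.cos (t * x) = 2 * (regLog R x - regLog ε x) := by
  have h1 : ∀ t, laplaceWeight ε R t * Real.cos (t * x) =
      ∫ s in ε..R, Real.exp (-s * |t|) * Real.cos (t * x) := fun t => by
    rw [laplaceWeight, intervalIntegral.integral_mul_const]
  simp_rw [h1]
  rw [← intervalIntegral_integral_swap (integrable_exp_cos_prod hε h x)]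
  have h2 : ∀ s ∈ Set.uIcc ε R, ∫ t : ℝ, Real.exp (-s * |t|) * Real.cos (t * x) =
      2 * (s / (x ^ 2 + s ^ 2)) := fun s hs => by
    rw [Set.uIcc_of_le h] at hs
    exact integral_exp_neg_mul_abs_mul_cos (hε.trans_le hs.1) x
  rw [intervalIntegral.integral_congr h2]
  have hpos : ∀ s ∈ Set.uIcc ε R, 0 < x ^ 2 + s ^ 2 := fun s hs => by
    rw [Set.uIcc_of_le h] at hs
    have := hε.trans_le hs.1
    positivity
  have hd : ∀ s ∈ Set.uIcc ε R,
      HasDerivAt (fun s => 2 * regLog s x) (2 * (s / (x ^ 2 + s ^ 2))) s := by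
    intro s hs
    have h3 : HasDerivAt (fun s : ℝ => x ^ 2 + s ^ 2) (2 * s) s := by
      simpa using (hasDerivAt_pow 2 s).const_add (x ^ 2)
    have h4 := ((h3.log (hpos s hs).ne').div_const 2).const_mul 2
    refine h4.congr_deriv ?_
    ring
  rw [intervalIntegral.integral_eq_sub_of_hasDerivAt hd]
  · ring
  · refine ContinuousOn.intervalIntegrable fun s hs => ContinuousAt.continuousWithinAt ?_
    have := (hpos s hs).ne'
    fun_prop (disch := assumption)

theorem integrable_laplaceWeight {ε R : ℝ} (hε : 0 < ε) (h : ε ≤ R) :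
    Integrable (laplaceWeight ε R) := by
  have h1 := (integrable_exp_cos_prod hε h 0).integral_prod_right
  refine h1.congr (ae_of_all _ fun t => ?_)
  simp [laplaceWeight, Function.uncurry, intervalIntegral.integral_of_le h, Set.uIoc_of_le h]

/-- The quadratic form of the kernel `k (x - y)` at the signed measure `α - β`. -/
def kernelForm (k : ℝ → ℝ) (α β : Measure ℝ) : ℝ :=
  ∫ p : ℝ × ℝ, k (p.1 - p.2) ∂(α.prod α) - 2 * ∫ p : ℝ × ℝ, k (p.1 - p.2) ∂(α.prod β) +
    ∫ p : ℝ × ℝ, k (p.1 - p.2) ∂(β.prod β)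

theorem charFun_re_im (α : Measure ℝ) [IsProbabilityMeasure α] (t : ℝ) :
    (charFun α t).re = ∫ x, Real.cos (t * x) ∂α ∧
      (charFun α t).im = ∫ x, Real.sin (t * x) ∂α := by
  have hi : Integrable (fun x : ℝ => Complex.exp (t * x * Complex.I)) α := by
    refine (integrable_const (1 : ℝ)).mono' (Continuous.aestronglyMeasurable (by fun_prop))
      (ae_of_all _ fun x => ?_)
    rw [← Complex.ofReal_mul, Complex.norm_exp_ofReal_mul_I]
  have h1 := integral_re (𝕜 := ℂ) hi
  have h2 := integral_im (𝕜 := ℂ) hi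
  simp only [RCLike.re_to_complex, RCLike.im_to_complex] at h1 h2
  rw [charFun_apply_real, ← h1, ← h2]
  constructor
  · refine integral_congr_ae (ae_of_all _ fun x => ?_)
    simp only []
    rw [← Complex.ofReal_mul, Complex.exp_ofReal_mul_I_re]
  · refine integral_congr_ae (ae_of_all _ fun x => ?_)
    simp only []
    rw [← Complex.ofReal_mul, Complex.exp_ofReal_mul_I_im]

theorem integral_cos_prod (α β : Measure ℝ) [IsProbabilityMeasure α] [IsProbabilityMeasure β]
    (t : ℝ) : ∫ p : ℝ × ℝ, Real.cos (t * (p.1 - p.2)) ∂(α.prod β) =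
      (charFun α t).re * (charFun β t).re + (charFun α t).im * (charFun β t).im := by
  obtain ⟨a1, a2⟩ := charFun_re_im α t
  obtain ⟨b1, b2⟩ := charFun_re_im β t
  have hb : ∀ f : ℝ × ℝ → ℝ, Continuous f → (∀ p, |f p| ≤ 1) → Integrable f (α.prod β) :=
    fun f hf h => (integrable_const (1 : ℝ)).mono' hf.aestronglyMeasurable
      (ae_of_all _ fun p => h p)
  rw [a1, a2, b1, b2, ← integral_prod_mul, ← integral_prod_mul, ← integral_add]
  · refine integral_congr_ae (ae_of_all _ fun p => ?_)
    simp only [mul_sub, Real.cos_sub]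
  · refine hb _ (by fun_prop) fun p => ?_
    rw [abs_mul]
    exact mul_le_one₀ (Real.abs_cos_le_one _) (abs_nonneg _) (Real.abs_cos_le_one _)
  · refine hb _ (by fun_prop) fun p => ?_
    rw [abs_mul]
    exact mul_le_one₀ (Real.abs_sin_le_one _) (abs_nonneg _) (Real.abs_sin_le_one _)

theorem kernelForm_cos (α β : Measure ℝ) [IsProbabilityMeasure α] [IsProbabilityMeasure β]
    (t : ℝ) : kernelForm (fun x => Real.cos (t * x)) α β = ‖charFun α t - charFun β t‖ ^ 2 := by
  rw [kernelForm, integral_cos_prod, integral_cos_prod, integral_cos_prod,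
    ← Complex.normSq_eq_norm_sq, Complex.normSq_apply, Complex.sub_re, Complex.sub_im]
  ring

theorem integral_mul_integral_cos {w : ℝ → ℝ} (hw : Integrable w) (α β : Measure ℝ)
    [IsProbabilityMeasure α] [IsProbabilityMeasure β] :
    Integrable (fun t => w t * ∫ p : ℝ × ℝ, Real.cos (t * (p.1 - p.2)) ∂(α.prod β)) ∧
    ∫ t, w t * ∫ p : ℝ × ℝ, Real.cos (t * (p.1 - p.2)) ∂(α.prod β) =
      ∫ p : ℝ × ℝ, (∫ t, w t * Real.cos (t * (p.1 - p.2))) ∂(α.prod β) := by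
  have hi : Integrable (Function.uncurry fun (t : ℝ) (p : ℝ × ℝ) =>
      w t * Real.cos (t * (p.1 - p.2))) ((volume : Measure ℝ).prod (α.prod β)) := by
    refine (hw.comp_fst (α.prod β)).mul_bdd (c := 1)
      (Continuous.aestronglyMeasurable (by fun_prop)) (ae_of_all _ fun q => ?_)
    exact Real.abs_cos_le_one _
  simp_rw [← integral_const_mul]
  exact ⟨hi.integral_prod_left, integral_integral_swap hi⟩

theorem integral_mul_norm_charFun_sub {w : ℝ → ℝ} (hw : Integrable w) (α β : Measure ℝ)
    [IsProbabilityMeasure α] [IsProbabilityMeasure β] :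
    Integrable (fun t => w t * ‖charFun α t - charFun β t‖ ^ 2) ∧
    ∫ t, w t * ‖charFun α t - charFun β t‖ ^ 2 =
      kernelForm (fun x => ∫ t, w t * Real.cos (t * x)) α β := by
  obtain ⟨a1, a2⟩ := integral_mul_integral_cos hw α α
  obtain ⟨b1, b2⟩ := integral_mul_integral_cos hw α β
  obtain ⟨c1, c2⟩ := integral_mul_integral_cos hw β β
  have heq : ∀ t, w t * ‖charFun α t - charFun β t‖ ^ 2 =
      w t * ∫ p : ℝ × ℝ, Real.cos (t * (p.1 - p.2)) ∂(α.prod α) -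
        2 * (w t * ∫ p : ℝ × ℝ, Real.cos (t * (p.1 - p.2)) ∂(α.prod β)) +
        w t * ∫ p : ℝ × ℝ, Real.cos (t * (p.1 - p.2)) ∂(β.prod β) := fun t => by
    rw [← kernelForm_cos, kernelForm]
    ring
  have hab : Integrable fun t =>
      w t * ∫ p : ℝ × ℝ, Real.cos (t * (p.1 - p.2)) ∂(α.prod α) -
        2 * (w t * ∫ p : ℝ × ℝ, Real.cos (t * (p.1 - p.2)) ∂(α.prod β)) :=
    a1.sub (b1.const_mul 2)
  simp_rw [heq]
  refine ⟨hab.add c1, ?_⟩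
  rw [integral_add hab c1, integral_sub a1 (b1.const_mul 2),
    integral_const_mul, a2, b2, c2, kernelForm]

theorem regLog_sub_log_bounds {R : ℝ} (hR : 1 ≤ R) (x : ℝ) :
    0 ≤ regLog R x - Real.log R ∧ regLog R x - Real.log R ≤ Real.log (1 + |x|) := by
  have hR0 : 0 < R := by linarith
  have h0 := abs_nonneg x
  have h1 : R ^ 2 ≤ x ^ 2 + R ^ 2 := by nlinarith
  have h2 : x ^ 2 + R ^ 2 ≤ ((1 + |x|) * R) ^ 2 := by
    rw [← sq_abs x]
    nlinarith [mul_nonneg h0 hR0.le, sq_nonneg (|x|), mul_nonneg (sq_nonneg (|x|))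
      (show 0 ≤ R ^ 2 - 1 by nlinarith), mul_nonneg h0 (sq_nonneg R)]
  have h3 := Real.log_le_log (by positivity) h1
  have h4 := Real.log_le_log (by positivity) h2
  rw [Real.log_pow] at h3 h4
  rw [Real.log_mul (by positivity) (by positivity)] at h4
  push_cast at h3 h4
  rw [regLog]
  constructor <;> linarith

theorem tendsto_regLog_sub_log (x : ℝ) :
    Tendsto (fun n : ℕ => regLog (n + 1) x - Real.log (n + 1)) atTop (𝓝 0) := by
  have h1 : Tendsto (fun n : ℕ => (x * (1 / ((n : ℝ) + 1))) ^ 2 + 1) atTop (𝓝 ((x * 0) ^ 2 + 1)) :=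
    ((tendsto_one_div_add_atTop_nhds_zero_nat.const_mul x).pow 2).add_const 1
  have h2 := (h1.log (by simp)).div_const 2
  simp only [mul_zero, ne_eq, OfNat.ofNat_ne_zero, not_false_eq_true, zero_pow, zero_add,
    Real.log_one, zero_div] at h2
  refine h2.congr fun n => ?_
  have hn : (0 : ℝ) < (n : ℝ) + 1 := by positivity
  have h3 : x ^ 2 + ((n : ℝ) + 1) ^ 2 =
      ((x * (1 / ((n : ℝ) + 1))) ^ 2 + 1) * ((n : ℝ) + 1) ^ 2 := by
    field_simp
  rw [regLog, h3, Real.log_mul (by positivity) (by positivity), Real.log_pow]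
  push_cast
  ring

theorem tendsto_integral_regLog {α β : Measure ℝ} (hα : HasLogMoment α) (hβ : HasLogMoment β) :
    Tendsto (fun n : ℕ => ∫ p : ℝ × ℝ, (regLog (n + 1) (p.1 - p.2) - Real.log (n + 1))
      ∂(α.prod β)) atTop (𝓝 0) := by
  have := hα.isProbabilityMeasure
  have := hβ.isProbabilityMeasure
  rw [← integral_zero (ℝ × ℝ) ℝ (μ := α.prod β)]
  refine tendsto_integral_of_dominated_convergence _ (fun n => ?_)
    (hα.integrable_log_prod hβ) (fun n => ae_of_all _ fun p => ?_)
    (ae_of_all _ fun p => tendsto_regLog_sub_log _)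
  · exact ((measurable_regLog _).comp (by fun_prop)).sub_const _ |>.aestronglyMeasurable
  · obtain ⟨h1, h2⟩ := regLog_sub_log_bounds (R := n + 1) (by simp) (p.1 - p.2)
    rw [Real.norm_of_nonneg h1]
    exact h2.trans (log_one_add_abs_sub_le _ _)

/-- Because `α - β` has total mass zero, `log R` may be subtracted from the kernel `regLog R`
without changing the form; what is left tends to zero by dominated convergence. -/
theorem tendsto_kernelForm_regLog {α β : Measure ℝ} (hα : HasLogMoment α)
    (hβ : HasLogMoment β) {ε : ℝ} (hε : 0 < ε) :
    Tendsto (fun n : ℕ => kernelForm (fun x => 2 * (regLog (n + 1) x - regLog ε x)) α β) atTop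
      (𝓝 (-2 * kernelForm (regLog ε) α β)) := by
  have := hα.isProbabilityMeasure
  have := hβ.isProbabilityMeasure
  have hlim := (((tendsto_integral_regLog hα hα).sub
    ((tendsto_integral_regLog hα hβ).const_mul 2)).add
    (tendsto_integral_regLog hβ hβ)).const_mul 2 |>.sub_const (2 * kernelForm (regLog ε) α β)
  have hsplit : ∀ {σ τ : Measure ℝ}, HasLogMoment σ → HasLogMoment τ → ∀ n : ℕ,
      ∫ p : ℝ × ℝ, 2 * (regLog (n + 1) (p.1 - p.2) - regLog ε (p.1 - p.2)) ∂(σ.prod τ) =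
        2 * ∫ p : ℝ × ℝ, (regLog (n + 1) (p.1 - p.2) - Real.log (n + 1)) ∂(σ.prod τ) +
        2 * Real.log (n + 1) - 2 * ∫ p : ℝ × ℝ, regLog ε (p.1 - p.2) ∂(σ.prod τ) := by
    intro σ τ hσ hτ n
    have := hσ.isProbabilityMeasure
    have := hτ.isProbabilityMeasure
    have h1 := integrable_regLog_prod hσ hτ (show (0 : ℝ) < n + 1 by positivity)
    rw [integral_const_mul, integral_sub h1 (integrable_regLog_prod hσ hτ hε),
      integral_sub h1 (integrable_const _)]
    simp
    ring
  convert hlim using 2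
  · rw [kernelForm, hsplit hα hα, hsplit hα hβ, hsplit hβ hβ, kernelForm]
    ring
  · ring

/-- Fatou's lemma removes the cutoff `R`: the Laplace weight tends to `e^{-ε|t|}/|t|` off the
origin, and the integrals converge to the right side. -/
theorem lintegral_exp_norm_charFun_sub_le {α β : Measure ℝ} (hα : HasLogMoment α)
    (hβ : HasLogMoment β) {ε : ℝ} (hε : 0 < ε) :
    ∫⁻ t : ℝ, ENNReal.ofReal (Real.exp (-ε * |t|) / |t| * ‖charFun α t - charFun β t‖ ^ 2) ≤
      ENNReal.ofReal (-2 * kernelForm (regLog ε) α β) := by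
  have := hα.isProbabilityMeasure
  have := hβ.isProbabilityMeasure
  set D : ℝ → ℝ := fun t => ‖charFun α t - charFun β t‖ ^ 2 with hD
  have hDm : Measurable D := by
    have h1 : Measurable (charFun α) := measurable_charFun
    have h2 : Measurable (charFun β) := measurable_charFun
    fun_prop
  have hlim := tendsto_kernelForm_regLog hα hβ hε
  have hR : ∀ᶠ n : ℕ in atTop, ε ≤ (n : ℝ) + 1 := by
    filter_upwards [tendsto_natCast_atTop_atTop.eventually_ge_atTop ε] with n hn
    linarith
  have hint : ∀ᶠ n : ℕ in atTop,
      ∫⁻ t, ENNReal.ofReal (laplaceWeight ε (n + 1) t * D t) =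
        ENNReal.ofReal (kernelForm (fun x => 2 * (regLog (n + 1) x - regLog ε x)) α β) := by
    filter_upwards [hR] with n hn
    obtain ⟨h1, h2⟩ := integral_mul_norm_charFun_sub (integrable_laplaceWeight hε hn) α β
    rw [← ofReal_integral_eq_lintegral_ofReal h1 (ae_of_all _ fun t =>
      mul_nonneg (laplaceWeight_nonneg hn t) (by positivity)), h2]
    simp_rw [integral_laplaceWeight_mul_cos hε hn]
  have hlim2 : Tendsto (fun n : ℕ => ∫⁻ t, ENNReal.ofReal (laplaceWeight ε (n + 1) t * D t)) atTop
      (𝓝 (ENNReal.ofReal (-2 * kernelForm (regLog ε) α β))) :=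
    (ENNReal.tendsto_ofReal hlim).congr' (hint.mono fun n hn => hn.symm)
  have hpt : ∀ᵐ t : ℝ, ENNReal.ofReal (Real.exp (-ε * |t|) / |t| * D t) ≤
      liminf (fun n : ℕ => ENNReal.ofReal (laplaceWeight ε (n + 1) t * D t)) atTop := by
    have hne : ∀ᵐ t : ℝ, t ≠ 0 := by simp [ae_iff]
    filter_upwards [hne] with t ht
    refine le_of_eq (Tendsto.liminf_eq ?_).symm
    refine ENNReal.tendsto_ofReal (Tendsto.mul_const _ ?_)
    have ht' : 0 < |t| := abs_pos.mpr ht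
    have h1 : Tendsto (fun n : ℕ => Real.exp (-((n : ℝ) + 1) * |t|)) atTop (𝓝 0) := by
      refine Real.tendsto_exp_atBot.comp ?_
      refine Tendsto.atBot_mul_const ht' ?_
      exact tendsto_neg_atTop_atBot.comp
        (tendsto_atTop_add_const_right _ _ tendsto_natCast_atTop_atTop)
    have h2 := (h1.const_sub (Real.exp (-ε * |t|))).div_const |t|
    rw [sub_zero] at h2
    refine h2.congr fun n => ?_
    rw [laplaceWeight_eq ε _ ht]
  calc ∫⁻ t : ℝ, ENNReal.ofReal (Real.exp (-ε * |t|) / |t| * D t)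
      ≤ ∫⁻ t, liminf (fun n : ℕ => ENNReal.ofReal (laplaceWeight ε (n + 1) t * D t)) atTop :=
        lintegral_mono_ae hpt
    _ ≤ liminf (fun n : ℕ => ∫⁻ t, ENNReal.ofReal (laplaceWeight ε (n + 1) t * D t)) atTop :=
        lintegral_liminf_le fun n =>
          ((continuous_laplaceWeight ε _).measurable.mul hDm).ennreal_ofReal
    _ = _ := hlim2.liminf_eq

/-! ### Mollification of test functions -/

/-- A smooth cutoff function that is `1` at the origin and vanishes outside `[-1, 1]`. -/
def cutoff : ContDiffBump (0 : ℝ) := ⟨1 / 2, 1, by norm_num, by norm_num⟩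

theorem cutoff_zero : cutoff (0 : ℝ) = 1 :=
  cutoff.one_of_mem_closedBall (Metric.mem_closedBall_self (by simp [cutoff]))

theorem abs_le_one_of_cutoff_ne_zero {x : ℝ} (h : cutoff x ≠ 0) : |x| ≤ 1 := by
  by_contra hc
  refine h (cutoff.zero_of_le_dist ?_)
  simpa [cutoff] using (not_le.mp hc).le

/-- The function `ξ ↦ χ (h ξ) exp (2 π i x ξ)`, where `χ` is the cutoff. -/
def modulatedCutoff (h x ξ : ℝ) : ℂ :=
  (cutoff (h * ξ) : ℂ) * Complex.exp ((2 * Real.pi * (x * ξ) : ℝ) * Complex.I)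

theorem norm_modulatedCutoff (h x ξ : ℝ) : ‖modulatedCutoff h x ξ‖ = cutoff (h * ξ) := by
  rw [modulatedCutoff, norm_mul, Complex.norm_exp_ofReal_mul_I, mul_one, Complex.norm_real,
    Real.norm_of_nonneg cutoff.nonneg]

theorem contDiff_modulatedCutoff (h x : ℝ) : ContDiff ℝ (↑(⊤ : ℕ∞)) (modulatedCutoff h x) := by
  have h1 : ContDiff ℝ (↑(⊤ : ℕ∞)) fun ξ : ℝ => cutoff (h * ξ) :=
    cutoff.contDiff.comp (contDiff_const.mul contDiff_id)
  have h2 : ContDiff ℝ (↑(⊤ : ℕ∞)) fun ξ : ℝ => (cutoff (h * ξ) : ℂ) :=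
    Complex.ofRealCLM.contDiff.comp h1
  have h3 : ContDiff ℝ (↑(⊤ : ℕ∞)) fun ξ : ℝ => ((2 * Real.pi * (x * ξ) : ℝ) : ℂ) :=
    Complex.ofRealCLM.contDiff.comp (contDiff_const.mul (contDiff_const.mul contDiff_id))
  exact h2.mul (h3.mul contDiff_const).cexp

theorem hasCompactSupport_modulatedCutoff {h : ℝ} (hh : 0 < h) (x : ℝ) :
    HasCompactSupport (modulatedCutoff h x) := by
  refine HasCompactSupport.of_support_subset_isCompact (isCompact_Icc (a := -h⁻¹) (b := h⁻¹))
    fun ξ hξ => ?_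
  have h1 : cutoff (h * ξ) ≠ 0 := fun h0 => hξ (by simp [modulatedCutoff, h0])
  have h2 := abs_le_one_of_cutoff_ne_zero h1
  rw [abs_mul, abs_of_pos hh] at h2
  rw [Set.mem_Icc, ← abs_le, inv_eq_one_div, le_div_iff₀ hh]
  linarith

/-- The modulated cutoff as a Schwartz function. -/
def schwartzCutoff {h : ℝ} (hh : 0 < h) (x : ℝ) : SchwartzMap ℝ ℂ :=
  (hasCompactSupport_modulatedCutoff hh x).toSchwartzMap (contDiff_modulatedCutoff h x)

theorem schwartzCutoff_apply {h : ℝ} (hh : 0 < h) (x ξ : ℝ) :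
    schwartzCutoff hh x ξ = modulatedCutoff h x ξ := rfl

/-- The Fourier transform of the cutoff. -/
def mollifier : SchwartzMap ℝ ℂ := 𝓕 (schwartzCutoff one_pos 0)

theorem mollifier_apply (s : ℝ) :
    mollifier s = ∫ v : ℝ, Complex.exp ((-2 * Real.pi * (v * s) : ℝ) * Complex.I) *
      (cutoff v : ℂ) := by
  rw [mollifier, SchwartzMap.fourier_coe, Real.fourier_eq']
  refine integral_congr_ae (ae_of_all _ fun v => ?_)
  simp [schwartzCutoff_apply, modulatedCutoff, mul_comm]

theorem integral_mollifier : ∫ s, mollifier s = 1 := by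
  have h1 : 𝓕⁻ mollifier = schwartzCutoff one_pos 0 := by
    rw [mollifier, FourierTransform.fourierInv_fourier_eq]
  have h2 := congrArg (fun f : SchwartzMap ℝ ℂ => f 0) h1
  simp only [SchwartzMap.fourierInv_coe, Real.fourierInv_eq'] at h2
  simpa [schwartzCutoff_apply, modulatedCutoff, cutoff_zero] using h2

/-- Dilation and modulation on the frequency side turn into an approximate identity of width `h`
centred at `x`. -/
theorem fourier_schwartzCutoff {h : ℝ} (hh : 0 < h) (x y : ℝ) :
    (𝓕 (schwartzCutoff hh x) : SchwartzMap ℝ ℂ) y = (h⁻¹ : ℝ) • mollifier ((y - x) / h) := by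
  rw [SchwartzMap.fourier_coe, Real.fourier_eq', mollifier_apply]
  have h1 := Measure.integral_comp_mul_left (fun v : ℝ =>
    Complex.exp ((-2 * Real.pi * (v * ((y - x) / h)) : ℝ) * Complex.I) * (cutoff v : ℂ)) h
  rw [abs_of_pos (inv_pos.mpr hh)] at h1
  rw [← h1]
  refine integral_congr_ae (ae_of_all _ fun ξ => ?_)
  simp only [schwartzCutoff_apply, modulatedCutoff, smul_eq_mul]
  rw [mul_left_comm, ← Complex.exp_add, mul_comm]
  congr 2
  rw [← add_mul, ← Complex.ofReal_add]
  congr 2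
  simp only [RCLike.inner_apply, conj_trivial]
  field_simp
  ring

/-- The `L²` Fourier transform agrees with that of tempered distributions, which is defined by this
duality. -/
theorem integral_schwartz_mul_fourier (f : Lp ℂ 2 (volume : Measure ℝ)) (g : SchwartzMap ℝ ℂ) :
    ∫ ξ, g ξ * (𝓕 f : Lp ℂ 2 (volume : Measure ℝ)) ξ = ∫ y, (𝓕 g : SchwartzMap ℝ ℂ) y * f y := by
  have h1 := congrArg (fun T => T g) (Lp.fourier_toTemperedDistribution_eq f)
  simp only [TemperedDistribution.fourier_apply, Lp.toTemperedDistribution_apply,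
    smul_eq_mul] at h1
  exact h1.symm

/-- The first absolute moment of the mollifier. -/
def mollifierMoment : ℝ := ∫ s, |s| * ‖mollifier s‖

theorem integrable_abs_mul_mollifier : Integrable fun s : ℝ => |s| * ‖mollifier s‖ := by
  simpa using mollifier.integrable_pow_mul volume 1

/-- The low-frequency part of `f` averages `f(x + h s)` against a kernel of integral one, and the
Lipschitz bound controls each displacement by `h|s|`. The estimate holds at every `x`, not just
almost everywhere, as the atoms of the empirical measure require. -/
theorem norm_integral_cutoff_fourier_sub_le {f : ℝ → ℝ} (hL : LipschitzWith 1 f)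
    (hf : MemLp (fun x => (f x : ℂ)) 2 (volume : Measure ℝ)) {h : ℝ} (hh : 0 < h) (x : ℝ) :
    ‖(∫ ξ, modulatedCutoff h x ξ * (𝓕 hf.toLp : Lp ℂ 2 (volume : Measure ℝ)) ξ) - f x‖ ≤
      h * mollifierMoment := by
  set F : Lp ℂ 2 (volume : Measure ℝ) := hf.toLp with hF
  have hlip : ∀ s, |f (x + h * s) - f x| ≤ h * |s| := fun s => by
    have := hL.dist_le_mul (x + h * s) x
    simpa [Real.dist_eq, abs_mul, abs_of_pos hh] using this
  have h1 : ∫ ξ, modulatedCutoff h x ξ * (𝓕 F : Lp ℂ 2 (volume : Measure ℝ)) ξ =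
      ∫ s, mollifier s * (f (x + h * s) : ℂ) := by
    set G : ℝ → ℂ := fun s => mollifier s * (f (x + h * s) : ℂ) with hG
    have e1 := integral_schwartz_mul_fourier F (schwartzCutoff hh x)
    have e2 : ∫ y, (𝓕 (schwartzCutoff hh x) : SchwartzMap ℝ ℂ) y * F y =
        ∫ y, (h⁻¹ : ℝ) • G ((y - x) / h) := by
      refine integral_congr_ae ?_
      filter_upwards [hf.coeFn_toLp] with y hy
      rw [hF, hy, fourier_schwartzCutoff]
      have : x + h * ((y - x) / h) = y := by field_simp; ring
      simp only [hG, this, smul_mul_assoc]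
    rw [e2, integral_smul, integral_sub_right_eq_self (fun y => G (y / h)) x,
      Measure.integral_comp_div G h, abs_of_pos hh, smul_smul, inv_mul_cancel₀ hh.ne',
      one_smul] at e1
    exact e1
  have hm : Continuous fun s : ℝ => ((f (x + h * s) - f x : ℝ) : ℂ) := by
    have := hL.continuous
    fun_prop
  have hi0 : Integrable fun s => mollifier s := mollifier.integrable
  have hbound : ∀ s, ‖mollifier s * ((f (x + h * s) - f x : ℝ) : ℂ)‖ ≤
      h * (|s| * ‖mollifier s‖) := fun s => by
    rw [norm_mul, Complex.norm_real, Real.norm_eq_abs]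
    have := mul_le_mul_of_nonneg_left (hlip s) (norm_nonneg (mollifier s))
    linarith
  have hi1 : Integrable fun s => mollifier s * ((f (x + h * s) - f x : ℝ) : ℂ) :=
    (integrable_abs_mul_mollifier.const_mul h).mono'
      (mollifier.continuous.mul hm).aestronglyMeasurable (ae_of_all _ hbound)
  have h2 : (∫ s, mollifier s * (f (x + h * s) : ℂ)) - f x =
      ∫ s, mollifier s * ((f (x + h * s) - f x : ℝ) : ℂ) := by
    have h3 : ∀ s, mollifier s * (f (x + h * s) : ℂ) =
        mollifier s * ((f (x + h * s) - f x : ℝ) : ℂ) + mollifier s * (f x : ℂ) := fun s => by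
      push_cast
      ring
    simp_rw [h3]
    rw [integral_add hi1 (hi0.mul_const _), integral_mul_const, integral_mollifier]
    ring
  rw [h1, h2]
  calc ‖∫ s, mollifier s * ((f (x + h * s) - f x : ℝ) : ℂ)‖
      ≤ ∫ s, h * (|s| * ‖mollifier s‖) :=
        norm_integral_le_of_norm_le (integrable_abs_mul_mollifier.const_mul h)
          (ae_of_all _ hbound)
    _ = h * mollifierMoment := by rw [integral_const_mul, mollifierMoment]

theorem integrable_modulatedCutoff_mul {h : ℝ} (hh : 0 < h) (x : ℝ)
    (F : Lp ℂ 2 (volume : Measure ℝ)) :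
    Integrable fun ξ => modulatedCutoff h x ξ * F ξ :=
  ((schwartzCutoff hh x).memLp 2).integrable_mul (Lp.memLp F)

theorem modulatedCutoff_eq (h x ξ : ℝ) :
    modulatedCutoff h x ξ = modulatedCutoff h 0 ξ *
      Complex.exp ((2 * Real.pi * ξ : ℝ) * x * Complex.I) := by
  simp only [modulatedCutoff, zero_mul, mul_zero, Complex.ofReal_zero, Complex.exp_zero, mul_one]
  push_cast
  ring_nf

theorem integral_integral_modulatedCutoff {h : ℝ} (hh : 0 < h)
    (F : Lp ℂ 2 (volume : Measure ℝ)) (α : Measure ℝ) [IsProbabilityMeasure α] :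
    Integrable (fun x => ∫ ξ, modulatedCutoff h x ξ * F ξ) α ∧
    Integrable (fun ξ => modulatedCutoff h 0 ξ * F ξ * charFun α (2 * Real.pi * ξ)) ∧
    ∫ x, (∫ ξ, modulatedCutoff h x ξ * F ξ) ∂α =
      ∫ ξ, modulatedCutoff h 0 ξ * F ξ * charFun α (2 * Real.pi * ξ) := by
  have hi : Integrable (Function.uncurry fun (x ξ : ℝ) =>
      modulatedCutoff h 0 ξ * F ξ * Complex.exp ((2 * Real.pi * ξ : ℝ) * x * Complex.I))
      (α.prod volume) := by
    refine ((integrable_modulatedCutoff_mul hh 0 F).comp_snd α).mul_bdd (c := 1)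
      (Continuous.aestronglyMeasurable (by fun_prop)) (ae_of_all _ fun p => ?_)
    rw [← Complex.ofReal_mul, Complex.norm_exp_ofReal_mul_I]
  have e : ∀ x : ℝ, ∫ ξ, modulatedCutoff h x ξ * F ξ = ∫ ξ, modulatedCutoff h 0 ξ * F ξ *
      Complex.exp ((2 * Real.pi * ξ : ℝ) * x * Complex.I) := fun x => by
    refine integral_congr_ae (ae_of_all _ fun ξ => ?_)
    simp only []
    rw [modulatedCutoff_eq]
    ring
  have e' : ∀ ξ : ℝ, modulatedCutoff h 0 ξ * F ξ * charFun α (2 * Real.pi * ξ) =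
      ∫ x, modulatedCutoff h 0 ξ * F ξ *
        Complex.exp ((2 * Real.pi * ξ : ℝ) * x * Complex.I) ∂α := fun ξ => by
    rw [integral_const_mul, charFun_apply_real]
  simp_rw [e, e']
  exact ⟨hi.integral_prod_left, hi.integral_prod_right, integral_integral_swap hi⟩

theorem lintegral_eq_mul_lintegral_div (G : ℝ → ℝ≥0∞) {c : ℝ} (hc : 0 < c) :
    ∫⁻ ξ, G ξ = ENNReal.ofReal c⁻¹ * ∫⁻ t, G (t / c) := by
  have h1 := Real.map_volume_mul_left hc.ne'
  have h2 : ∫⁻ t, G (t / c) ∂(Measure.map (c * ·) volume) = ∫⁻ ξ, G ξ := by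
    rw [show (fun x => c * x) = ⇑(Homeomorph.mulLeft₀ c hc.ne') from rfl,
      (Homeomorph.mulLeft₀ c hc.ne').measurableEmbedding.lintegral_map]
    refine lintegral_congr fun ξ => ?_
    simp [hc.ne']
  rw [← h2, h1, lintegral_smul_measure, abs_of_pos (inv_pos.mpr hc), smul_eq_mul]

/-- The substitution `t = 2πξ` gives the prefactor. In Cauchy-Schwarz, `|t|^{1/2}` goes to the test
function and `|t|^{-1/2}` to the measures; on the support of the cutoff `|t| ≤ 2π/h`, so the missing
damping `e^{-ε|t|}` costs at most `e^{2πε/h}`. -/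
theorem enorm_integral_cutoff_fourier_le {α β : Measure ℝ} (hα : HasLogMoment α)
    (hβ : HasLogMoment β) (F : Lp ℂ 2 (volume : Measure ℝ)) (hF : halfNormSq F ≤ 1) {ε h : ℝ}
    (hε : 0 < ε) (hh : 0 < h) :
    ‖∫ ξ, modulatedCutoff h 0 ξ * (𝓕 F : Lp ℂ 2 (volume : Measure ℝ)) ξ *
      (charFun α (2 * Real.pi * ξ) - charFun β (2 * Real.pi * ξ))‖ₑ ≤
      ENNReal.ofReal (2 * Real.pi)⁻¹ * (ENNReal.ofReal (Real.exp (2 * Real.pi * ε / h)) *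
        ENNReal.ofReal (-2 * kernelForm (regLog ε) α β)) ^ (1 / 2 : ℝ) := by
  have := hα.isProbabilityMeasure
  have := hβ.isProbabilityMeasure
  have hpi : (0 : ℝ) < 2 * Real.pi := by positivity
  set D : ℝ → ℂ := fun t => charFun α t - charFun β t with hD
  have hDm : Measurable D := by
    have h1 : Measurable (charFun α) := measurable_charFun
    have h2 : Measurable (charFun β) := measurable_charFun
    fun_prop
  have hFm : Measurable (fourierL2 F) :=
    (Lp.stronglyMeasurable (𝓕 F : Lp ℂ 2 (volume : Measure ℝ))).measurable.comp (by fun_prop)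
  have hcm : Continuous fun t : ℝ => cutoff (h * (t / (2 * Real.pi))) :=
    cutoff.continuous.comp (by fun_prop)
  set u : ℝ → ℝ≥0∞ := fun t => ENNReal.ofReal (√|t|) * ‖fourierL2 F t‖ₑ with hu
  set v : ℝ → ℝ≥0∞ := fun t =>
    ENNReal.ofReal (√(|t|⁻¹) * cutoff (h * (t / (2 * Real.pi))) * ‖D t‖) with hv
  have hum : Measurable u := by
    have := hFm.enorm
    fun_prop
  have hvm : Measurable v := by
    have := hcm.measurable
    have := hDm.norm
    fun_prop
  have hne : ∀ᵐ t : ℝ, t ≠ 0 := by simp [ae_iff]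
  have huv : ∫⁻ t, ‖modulatedCutoff h 0 (t / (2 * Real.pi)) * fourierL2 F t * D t‖ₑ ≤
      ∫⁻ t, (u * v) t := by
    refine lintegral_mono_ae (hne.mono fun t ht => le_of_eq ?_)
    have ht' : 0 < |t| := abs_pos.mpr ht
    have h1 : √|t| * √(|t|⁻¹) = 1 := by
      rw [← Real.sqrt_mul ht'.le, mul_inv_cancel₀ ht'.ne', Real.sqrt_one]
    rw [Pi.mul_apply, hu, hv]
    simp only [enorm_mul]
    rw [← ofReal_norm (modulatedCutoff h 0 (t / (2 * Real.pi))), norm_modulatedCutoff,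
      ← ofReal_norm (D t), mul_right_comm (ENNReal.ofReal (√|t|)),
      ← ENNReal.ofReal_mul (Real.sqrt_nonneg _),
      mul_right_comm _ (‖fourierL2 F t‖ₑ), ← ENNReal.ofReal_mul cutoff.nonneg]
    congr 2
    rw [← mul_assoc, ← mul_assoc, h1, one_mul]
  have hu2 : ∫⁻ t, u t ^ (2 : ℝ) ≤ 1 := by
    refine le_trans (le_of_eq ?_) hF
    rw [halfNormSq]
    refine lintegral_congr fun t => ?_
    rw [hu]
    simp only [ENNReal.rpow_ofNat]
    rw [mul_pow, ← ENNReal.ofReal_pow (Real.sqrt_nonneg _), Real.sq_sqrt (abs_nonneg t),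
      ← Real.norm_eq_abs, ofReal_norm]
  have hv2 : ∫⁻ t, v t ^ (2 : ℝ) ≤ ENNReal.ofReal (Real.exp (2 * Real.pi * ε / h)) *
      ENNReal.ofReal (-2 * kernelForm (regLog ε) α β) := by
    refine le_trans ?_ (mul_le_mul_right (lintegral_exp_norm_charFun_sub_le hα hβ hε) _)
    rw [← lintegral_const_mul' _ _ ENNReal.ofReal_ne_top]
    refine lintegral_mono fun t => ?_
    rw [hv]
    simp only [ENNReal.rpow_ofNat]
    rw [← ENNReal.ofReal_pow (mul_nonneg (mul_nonneg (Real.sqrt_nonneg _) cutoff.nonneg)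
      (norm_nonneg _)), ← ENNReal.ofReal_mul (Real.exp_nonneg _), mul_pow, mul_pow,
      Real.sq_sqrt (by positivity)]
    refine ENNReal.ofReal_le_ofReal ?_
    rw [← mul_assoc]
    refine mul_le_mul_of_nonneg_right ?_ (by positivity)
    by_cases h0 : cutoff (h * (t / (2 * Real.pi))) = 0
    · rw [h0]
      have : 0 ≤ Real.exp (2 * Real.pi * ε / h) * (Real.exp (-ε * |t|) / |t|) := by positivity
      simpa using this
    · have h1 := abs_le_one_of_cutoff_ne_zero h0
      rw [abs_mul, abs_of_pos hh, abs_div, abs_of_pos hpi] at h1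
      have h2 : |t| ≤ 2 * Real.pi / h := by
        rw [le_div_iff₀ hh]
        rw [mul_div_assoc', div_le_one hpi] at h1
        linarith
      have h3 : (cutoff (h * (t / (2 * Real.pi)))) ^ 2 ≤ 1 :=
        pow_le_one₀ cutoff.nonneg cutoff.le_one
      have h4 : 1 ≤ Real.exp (2 * Real.pi * ε / h) * Real.exp (-ε * |t|) := by
        rw [← Real.exp_add]
        refine Real.one_le_exp ?_
        have := mul_le_mul_of_nonneg_left h2 hε.le
        have e : ε * (2 * Real.pi / h) = 2 * Real.pi * ε / h := by ring
        linarith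
      calc |t|⁻¹ * cutoff (h * (t / (2 * Real.pi))) ^ 2 ≤ |t|⁻¹ * 1 := by gcongr
        _ ≤ |t|⁻¹ * (Real.exp (2 * Real.pi * ε / h) * Real.exp (-ε * |t|)) := by gcongr
        _ = _ := by ring
  calc _ ≤ ∫⁻ ξ, ‖modulatedCutoff h 0 ξ * (𝓕 F : Lp ℂ 2 (volume : Measure ℝ)) ξ *
        (charFun α (2 * Real.pi * ξ) - charFun β (2 * Real.pi * ξ))‖ₑ :=
        enorm_integral_le_lintegral_enorm _
    _ = ENNReal.ofReal (2 * Real.pi)⁻¹ *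
        ∫⁻ t, ‖modulatedCutoff h 0 (t / (2 * Real.pi)) * fourierL2 F t * D t‖ₑ := by
        rw [lintegral_eq_mul_lintegral_div _ hpi]
        congr 1
        refine lintegral_congr fun t => ?_
        rw [mul_div_cancel₀ _ hpi.ne', fourierL2]
    _ ≤ ENNReal.ofReal (2 * Real.pi)⁻¹ * ((∫⁻ t, u t ^ (2 : ℝ)) ^ (1 / 2 : ℝ) *
        (∫⁻ t, v t ^ (2 : ℝ)) ^ (1 / 2 : ℝ)) := by
        gcongr
        exact huv.trans (ENNReal.lintegral_mul_le_Lp_mul_Lq _ Real.HolderConjugate.two_two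
          hum.aemeasurable hvm.aemeasurable)
    _ ≤ ENNReal.ofReal (2 * Real.pi)⁻¹ * ((1 : ℝ≥0∞) ^ (1 / 2 : ℝ) *
        (ENNReal.ofReal (Real.exp (2 * Real.pi * ε / h)) *
          ENNReal.ofReal (-2 * kernelForm (regLog ε) α β)) ^ (1 / 2 : ℝ)) := by
        gcongr
    _ = _ := by rw [ENNReal.one_rpow, one_mul]

theorem abs_integral_sub_integral_le {f : ℝ → ℝ} (hf : IsTestFunction f) {α β : Measure ℝ}
    (hα : HasLogMoment α) (hβ : HasLogMoment β) (hfα : Integrable f α) (hfβ : Integrable f β)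
    {ε h : ℝ} (hε : 0 < ε) (hh : 0 < h) :
    |∫ x, f x ∂α - ∫ x, f x ∂β| ≤ 2 * (h * mollifierMoment) +
      (2 * Real.pi)⁻¹ *
        √(Real.exp (2 * Real.pi * ε / h) * (-2 * kernelForm (regLog ε) α β)) := by
  have := hα.isProbabilityMeasure
  have := hβ.isProbabilityMeasure
  obtain ⟨hL, hm, hn⟩ := hf
  set F : Lp ℂ 2 (volume : Measure ℝ) := hm.toLp with hFdef
  set g : ℝ → ℂ := fun x => ∫ ξ, modulatedCutoff h x ξ * (𝓕 F : Lp ℂ 2 (volume : Measure ℝ)) ξ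
    with hg
  have hclose : ∀ x, ‖g x - f x‖ ≤ h * mollifierMoment := fun x =>
    norm_integral_cutoff_fourier_sub_le hL hm hh x
  obtain ⟨a1, a2, a3⟩ := integral_integral_modulatedCutoff hh (𝓕 F) α
  obtain ⟨b1, b2, b3⟩ := integral_integral_modulatedCutoff hh (𝓕 F) β
  have hsm : ∀ {σ : Measure ℝ} [IsProbabilityMeasure σ], Integrable g σ → Integrable f σ →
      ‖∫ x, g x ∂σ - (∫ x, f x ∂σ : ℝ)‖ ≤ h * mollifierMoment := by
    intro σ _ hgσ hfσ
    have hfσ' : Integrable (fun x => (f x : ℂ)) σ := hfσ.ofReal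
    rw [← integral_complex_ofReal, ← integral_sub hgσ hfσ']
    refine (norm_integral_le_of_norm_le_const (ae_of_all _ hclose)).trans (by simp)
  have hmain : ‖∫ x, g x ∂α - ∫ x, g x ∂β‖ ≤ (2 * Real.pi)⁻¹ *
      √(Real.exp (2 * Real.pi * ε / h) * (-2 * kernelForm (regLog ε) α β)) := by
    have h1 := enorm_integral_cutoff_fourier_le hα hβ F hn hε hh
    simp_rw [mul_sub] at h1
    rw [integral_sub a2 b2, ← a3, ← b3] at h1
    rw [← ENNReal.ofReal_mul (Real.exp_nonneg _), ← ofReal_norm] at h1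
    have h2 : ENNReal.ofReal (Real.exp (2 * Real.pi * ε / h) *
        (-2 * kernelForm (regLog ε) α β)) ^ (1 / 2 : ℝ) =
        ENNReal.ofReal
          (√(Real.exp (2 * Real.pi * ε / h) * (-2 * kernelForm (regLog ε) α β))) := by
      rcases le_total 0 (Real.exp (2 * Real.pi * ε / h) * (-2 * kernelForm (regLog ε) α β))
        with h0 | h0
      · rw [ENNReal.ofReal_rpow_of_nonneg h0 (by norm_num), Real.sqrt_eq_rpow]
      · rw [ENNReal.ofReal_of_nonpos h0, Real.sqrt_eq_zero_of_nonpos h0]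
        simp
    rw [h2, ← ENNReal.ofReal_mul (by positivity)] at h1
    exact (ENNReal.ofReal_le_ofReal_iff (by positivity)).mp h1
  have hA := hsm a1 hfα
  have hB := hsm b1 hfβ
  rw [← Real.norm_eq_abs, ← Complex.norm_real]
  have e : ((∫ x, f x ∂α - ∫ x, f x ∂β : ℝ) : ℂ) =
      (∫ x, g x ∂α - ∫ x, g x ∂β) - (∫ x, g x ∂α - (∫ x, f x ∂α : ℝ)) +
        (∫ x, g x ∂β - (∫ x, f x ∂β : ℝ)) := by
    push_cast
    ring
  rw [e]
  refine (norm_add_le _ _).trans ?_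
  have h3 := norm_sub_le (∫ x, g x ∂α - ∫ x, g x ∂β) (∫ x, g x ∂α - (∫ x, f x ∂α : ℝ))
  linarith

/-! ### The `N`-particle measure -/

theorem integrable_gibbs_density {V u : ℝ → ℝ} (hV : Measurable V) (hu : Measurable u) (ℓ : ℝ)
    [IsProbabilityMeasure (gibbs V u ℓ)] : Integrable fun x => Real.exp (-V x + u x - ℓ) := by
  simpa using (integrable_gibbs_iff hV hu ℓ fun _ => 1).mp (integrable_const 1)

theorem pi_gibbs {V u : ℝ → ℝ} (hV : Measurable V) (hu : Measurable u) (ℓ : ℝ)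
    [IsProbabilityMeasure (gibbs V u ℓ)] (N : ℕ) :
    Measure.pi (fun _ : Fin N => gibbs V u ℓ) =
      (volume : Measure (Fin N → ℝ)).withDensity
        fun x => ENNReal.ofReal (Real.exp (∑ i, (-V (x i) + u (x i) - ℓ))) := by
  have hq := integrable_gibbs_density hV hu ℓ
  refine Measure.pi_eq fun s hs => ?_
  set f : Fin N → ℝ → ℝ := fun i => (s i).indicator fun x => Real.exp (-V x + u x - ℓ) with hf
  have hf0 : ∀ i x, 0 ≤ f i x := fun i x => Set.indicator_nonneg (fun _ _ => Real.exp_nonneg _) x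
  have hfi : ∀ i, Integrable (f i) := fun i => hq.indicator (hs i)
  have hind : ∀ x : Fin N → ℝ, (Set.univ.pi s).indicator
      (fun x => ENNReal.ofReal (Real.exp (∑ i, (-V (x i) + u (x i) - ℓ)))) x =
      ENNReal.ofReal (∏ i, f i (x i)) := fun x => by
    by_cases hx : x ∈ Set.univ.pi s
    · rw [Set.indicator_of_mem hx, Real.exp_sum]
      congr 1
      refine Finset.prod_congr rfl fun i _ => ?_
      rw [hf]
      simp only []
      rw [Set.indicator_of_mem (hx i (Set.mem_univ i))]
    · rw [Set.indicator_of_notMem hx]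
      obtain ⟨i, hi⟩ : ∃ i, x i ∉ s i := by
        by_contra hc
        push Not at hc
        exact hx fun i _ => hc i
      rw [Finset.prod_eq_zero (Finset.mem_univ i), ENNReal.ofReal_zero]
      exact Set.indicator_of_notMem hi _
  rw [withDensity_apply _ (MeasurableSet.univ_pi hs),
    ← lintegral_indicator (MeasurableSet.univ_pi hs)]
  simp_rw [hind]
  have hprod : Integrable (fun x : Fin N → ℝ => ∏ i, f i (x i)) volume :=
    Integrable.fintype_prod hfi
  rw [← ofReal_integral_eq_lintegral_ofReal hprod
    (ae_of_all _ fun x => Finset.prod_nonneg fun i _ => hf0 i (x i)),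
    integral_fintype_prod_volume_eq_prod,
    ENNReal.ofReal_prod_of_nonneg fun i _ => integral_nonneg (hf0 i)]
  refine Finset.prod_congr rfl fun i _ => ?_
  rw [ofReal_integral_eq_lintegral_ofReal (hfi i) (ae_of_all _ (hf0 i)), gibbs,
    withDensity_apply _ (hs i), ← lintegral_indicator (hs i)]
  refine lintegral_congr fun x => ?_
  by_cases hx : x ∈ s i <;> simp [hf, hx]

theorem measurePreserving_pair {N : ℕ} (μ : Measure ℝ) [IsProbabilityMeasure μ] {i j : Fin N}
    (hij : i ≠ j) :
    MeasurePreserving (fun x : Fin N → ℝ => (x i, x j)) (Measure.pi fun _ => μ) (μ.prod μ) := by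
  refine ⟨by fun_prop, ?_⟩
  have h := (ProbabilityTheory.iIndepFun_pi (μ := fun _ : Fin N => μ) (X := fun _ => id)
    fun _ => aemeasurable_id).indepFun hij
  simp only [id_eq] at h
  rw [ProbabilityTheory.indepFun_iff_map_prod_eq_prod_map_map
    (measurable_pi_apply i).aemeasurable (measurable_pi_apply j).aemeasurable] at h
  refine h.trans ?_
  congr 1
  · exact (measurePreserving_eval (fun _ : Fin N => μ) i).map_eq
  · exact (measurePreserving_eval (fun _ : Fin N => μ) j).map_eq

theorem ae_prod_ne {μ : Measure ℝ} [IsProbabilityMeasure μ] [NullSingletonClass μ] (α : Measure ℝ)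
    [IsProbabilityMeasure α] : ∀ᵐ p ∂(α.prod μ), p.1 - p.2 ≠ 0 := by
  have hm : MeasurableSet {p : ℝ × ℝ | p.1 - p.2 ≠ 0} :=
    (measurableSet_singleton (0 : ℝ)).compl.preimage (by fun_prop)
  rw [Measure.ae_prod_iff_ae_ae hm]
  refine ae_of_all _ fun x => ?_
  have : ∀ᵐ y ∂μ, y ≠ x := by simp [ae_iff, NullSingletonClass.measure_singleton]
  filter_upwards [this] with y hy
  exact sub_ne_zero.mpr hy.symm

theorem two_mul_sum_sum_Ioi {N : ℕ} (k : Fin N → Fin N → ℝ) (hk : ∀ i j, k i j = k j i) :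
    2 * ∑ i, ∑ j ∈ Finset.Ioi i, k i j = ∑ i, ∑ j, k i j - ∑ i, k i i := by
  have h := Finset.sum_sum_Ioi_add_eq_sum_sum_off_diag k
  have h1 : ∑ i, ∑ j ∈ Finset.Ioi i, (k j i + k i j) = 2 * ∑ i, ∑ j ∈ Finset.Ioi i, k i j := by
    simp_rw [Finset.mul_sum]
    refine Finset.sum_congr rfl fun i _ => Finset.sum_congr rfl fun j _ => ?_
    rw [hk j i]
    ring
  rw [← h1, h, ← Finset.sum_sub_distrib]
  refine Finset.sum_congr rfl fun i _ => ?_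
  rw [← Finset.sum_add_sum_compl {i} (fun j => k i j), Finset.sum_singleton, add_sub_cancel_left]
  exact Finset.sum_congr rfl fun j _ => hk j i

theorem empiricalMeasure_isProbabilityMeasure {N : ℕ} (hN : 1 ≤ N) (x : Fin N → ℝ) :
    IsProbabilityMeasure (empiricalMeasure N x) := by
  constructor
  have : (N : ℝ≥0∞) ≠ 0 := by
    rw [Nat.cast_ne_zero]
    omega
  simp [empiricalMeasure, ENNReal.inv_mul_cancel this (ENNReal.natCast_ne_top N)]

theorem integrable_empiricalMeasure {N : ℕ} (hN : 1 ≤ N) (x : Fin N → ℝ) (f : ℝ → ℝ) :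
    Integrable f (empiricalMeasure N x) := by
  refine Integrable.smul_measure ?_ ?_
  · rw [integrable_finsetSum_measure]
    exact fun i _ => integrable_dirac (by simp)
  · rw [ENNReal.inv_ne_top, Nat.cast_ne_zero]
    omega

theorem integral_empiricalMeasure (N : ℕ) (x : Fin N → ℝ) (f : ℝ → ℝ) :
    ∫ y, f y ∂(empiricalMeasure N x) = (N : ℝ)⁻¹ * ∑ i, f (x i) := by
  rw [empiricalMeasure, integral_smul_measure,
    integral_finsetSum_measure fun i _ => integrable_dirac (by simp)]
  simp

theorem hasLogMoment_empiricalMeasure {N : ℕ} (hN : 1 ≤ N) (x : Fin N → ℝ) :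
    HasLogMoment (empiricalMeasure N x) :=
  ⟨empiricalMeasure_isProbabilityMeasure hN x, integrable_empiricalMeasure hN x _⟩

theorem regLog_zero {ε : ℝ} : regLog ε 0 = Real.log ε := by
  rw [regLog]
  simp

theorem regLog_sub_comm (ε x y : ℝ) : regLog ε (x - y) = regLog ε (y - x) := by
  rw [regLog, regLog, ← neg_sub, neg_sq]

theorem kernelForm_empiricalMeasure {μ : Measure ℝ} (hμ : HasLogMoment μ) {N : ℕ} (hN : 1 ≤ N)
    (x : Fin N → ℝ) {ε : ℝ} (hε : 0 < ε) :
    kernelForm (regLog ε) (empiricalMeasure N x) μ =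
      (N : ℝ)⁻¹ * ((N : ℝ)⁻¹ * ∑ i, ∑ j, regLog ε (x i - x j)) -
        2 * ((N : ℝ)⁻¹ * ∑ i, ∫ y, regLog ε (x i - y) ∂μ) +
        ∫ p : ℝ × ℝ, regLog ε (p.1 - p.2) ∂(μ.prod μ) := by
  have he := hasLogMoment_empiricalMeasure hN x
  have := hμ.isProbabilityMeasure
  have := he.isProbabilityMeasure
  rw [kernelForm, integral_prod _ (integrable_regLog_prod he he hε),
    integral_prod _ (integrable_regLog_prod he hμ hε)]
  simp only [integral_empiricalMeasure]
  rw [← Finset.mul_sum]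

/-- The deviation of the `N`-particle density from the product of equilibrium measures is
governed by the regularised logarithmic energy. -/
theorem weight_le {V : ℝ → ℝ} {P : ℝ} (hP : 0 < P) {μ : Measure ℝ} (hμ : HasLogMoment μ)
    (hb : HasBoundedDensity μ) {C : ℝ}
    (hC : ∀ ε : ℝ, 0 < ε → ∀ x : ℝ, ∫ y, regLog ε (x - y) ∂μ ≤ logPotential μ x + C * √ε)
    (ℓ : ℝ) {N : ℕ} (hN : 1 ≤ N) {ε : ℝ} (hε : 0 < ε) (x : Fin N → ℝ) :
    weight V P N x ≤ Real.exp (N * ℓ - N * P * logEnergy μ μ + 2 * P * N * (C * √ε) -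
        P * Real.log ε + N * P * kernelForm (regLog ε) (empiricalMeasure N x) μ) *
      Real.exp (∑ i, (-V (x i) + 2 * P * logPotential μ (x i) - ℓ)) := by
  have := hμ.isProbabilityMeasure
  have := hb.nullSingletonClass
  have hN0 : (0 : ℝ) < N := by exact_mod_cast hN
  have hprod : ∏ i, ∏ j ∈ Finset.Ioi i, |x i - x j| ^ (2 * P / (N : ℝ)) ≤
      Real.exp (2 * P / N * ∑ i, ∑ j ∈ Finset.Ioi i, regLog ε (x i - x j)) := by
    simp_rw [Finset.mul_sum, Real.exp_sum]
    refine Finset.prod_le_prod (fun i _ => by positivity) fun i _ =>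
      Finset.prod_le_prod (fun j _ => by positivity) fun j _ => ?_
    -- For coinciding particles the factor is zero, because the exponent `2P/N` is positive.
    rcases eq_or_ne (x i - x j) 0 with h0 | h0
    · rw [h0, abs_zero, Real.zero_rpow (by positivity)]
      positivity
    · rw [Real.rpow_def_of_pos (abs_pos.mpr h0), mul_comm]
      refine Real.exp_le_exp.mpr (mul_le_mul_of_nonneg_left (log_abs_le_regLog ε h0) ?_)
      positivity
  have hI : logEnergy μ μ ≤ ∫ p : ℝ × ℝ, regLog ε (p.1 - p.2) ∂(μ.prod μ) :=
    integral_mono_ae (integrable_log_abs_prod hμ hμ hb) (integrable_regLog_prod hμ hμ hε)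
      ((ae_prod_ne μ).mono fun p hp => log_abs_le_regLog ε hp)
  -- The diagonal contributes `N log ε`; multiplied by `P/N` it is the source of the term `-P log
  -- ε`.
  have hS := two_mul_sum_sum_Ioi (fun i j => regLog ε (x i - x j))
    fun i j => regLog_sub_comm ε (x i) (x j)
  simp only [sub_self, regLog_zero, Finset.sum_const, Finset.card_univ, Fintype.card_fin,
    nsmul_eq_mul] at hS
  have hU : ∑ i, ∫ y, regLog ε (x i - y) ∂μ ≤ ∑ i, logPotential μ (x i) + N * (C * √ε) := by
    refine (Finset.sum_le_sum fun i _ => hC ε hε (x i)).trans (le_of_eq ?_)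
    rw [Finset.sum_add_distrib]
    simp
  have hsum : ∑ i, (-V (x i) + 2 * P * logPotential μ (x i) - ℓ) =
      -∑ i, V (x i) + 2 * P * ∑ i, logPotential μ (x i) - N * ℓ := by
    rw [Finset.sum_sub_distrib, Finset.sum_add_distrib, Finset.sum_neg_distrib, Finset.mul_sum]
    simp
  rw [weight, ← Real.exp_add]
  refine (mul_le_mul_of_nonneg_right hprod (Real.exp_nonneg _)).trans ?_
  rw [← Real.exp_add]
  refine Real.exp_le_exp.mpr ?_
  rw [hsum, kernelForm_empiricalMeasure hμ hN x hε]
  set A := ∑ i, ∑ j, regLog ε (x i - x j)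
  set B := ∑ i, ∫ y, regLog ε (x i - y) ∂μ
  set J := ∫ p : ℝ × ℝ, regLog ε (p.1 - p.2) ∂(μ.prod μ)
  have e1 : 2 * P / N * ∑ i, ∑ j ∈ Finset.Ioi i, regLog ε (x i - x j) =
      P / N * A - P * Real.log ε := by
    have : 2 * P / N * ∑ i, ∑ j ∈ Finset.Ioi i, regLog ε (x i - x j) =
        P / N * (2 * ∑ i, ∑ j ∈ Finset.Ioi i, regLog ε (x i - x j)) := by ring
    rw [this, hS]
    field_simp
  have e2 : N * P * ((N : ℝ)⁻¹ * ((N : ℝ)⁻¹ * A) - 2 * ((N : ℝ)⁻¹ * B) + J) =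
      P / N * A - 2 * P * B + N * P * J := by
    field_simp
  rw [e1, e2]
  have h1 := mul_le_mul_of_nonneg_left hI (show 0 ≤ N * P by positivity)
  have h2 := mul_le_mul_of_nonneg_left hU (show 0 ≤ 2 * P by positivity)
  linarith

/-- Jensen's inequality for the exponential; if `e^G` is not integrable, the right side is infinite.
-/
theorem ofReal_exp_integral_le {X : Type*} [MeasurableSpace X] {σ : Measure X}
    [IsProbabilityMeasure σ] {G : X → ℝ} (hG : Integrable G σ) :
    ENNReal.ofReal (Real.exp (∫ x, G x ∂σ)) ≤ ∫⁻ x, ENNReal.ofReal (Real.exp (G x)) ∂σ := by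
  by_cases hi : Integrable (fun x => Real.exp (G x)) σ
  · rw [← ofReal_integral_eq_lintegral_ofReal hi (ae_of_all _ fun x => Real.exp_nonneg _)]
    refine ENNReal.ofReal_le_ofReal ?_
    exact convexOn_exp.map_integral_le Real.continuous_exp.continuousOn isClosed_univ
      (ae_of_all _ fun x => Set.mem_univ _) hG hi
  · have htop : ∫⁻ x, ENNReal.ofReal (Real.exp (G x)) ∂σ = ∞ := by
      by_contra hne
      refine hi ⟨Real.continuous_exp.comp_aestronglyMeasurable hG.1, ?_⟩
      rw [hasFiniteIntegral_iff_ofReal (ae_of_all _ fun x => Real.exp_nonneg _)]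
      exact lt_top_iff_ne_top.mpr hne
    rw [htop]
    exact le_top

/-- The partition function is the mean of `e^G` under `μ^{⊗N}`. Jensen leaves the mean of `G`: the
`N(N-1)/2` pairs contribute `P(N-1)` logarithmic energies, and the potentials subtract `2PN` of
them. -/
theorem le_partitionFunction {V : ℝ → ℝ} (hV : Measurable V) {P : ℝ} {μ : Measure ℝ}
    (hμ : HasLogMoment μ) (hb : HasBoundedDensity μ) {ℓ : ℝ}
    (hg : μ = gibbs V (fun x => 2 * P * logPotential μ x) ℓ) {N : ℕ} (hN : 1 ≤ N) :
    ENNReal.ofReal (Real.exp (N * ℓ - N * P * logEnergy μ μ - P * logEnergy μ μ)) ≤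
      partitionFunction V P N := by
  have hμp := hμ.isProbabilityMeasure
  have := hb.nullSingletonClass
  have hN0 : (0 : ℝ) < N := by exact_mod_cast hN
  set U := logPotential μ with hU
  have hUm : Measurable U := measurable_logPotential μ
  set u : ℝ → ℝ := fun x => 2 * P * U x with hu
  have hum : Measurable u := hUm.const_mul _
  have hgp : IsProbabilityMeasure (gibbs V u ℓ) := hg ▸ hμp
  set σ : Measure (Fin N → ℝ) := Measure.pi fun _ => μ with hσ
  have hσd : σ = (volume : Measure (Fin N → ℝ)).withDensity
      fun x => ENNReal.ofReal (Real.exp (∑ i, (-V (x i) + u (x i) - ℓ))) := by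
    rw [hσ, ← pi_gibbs hV hum ℓ N, ← hg]
  set G : (Fin N → ℝ) → ℝ := fun x =>
    2 * P / N * ∑ i, ∑ j ∈ Finset.Ioi i, Real.log |x i - x j| + (N * ℓ - ∑ i, u (x i)) with hGdef
  have hlog := integrable_log_abs_prod hμ hμ hb
  have hpair : ∀ i, ∀ j ∈ Finset.Ioi i, Integrable (fun x : Fin N → ℝ => Real.log |x i - x j|) σ ∧
      ∫ x, Real.log |x i - x j| ∂σ = logEnergy μ μ := by
    intro i j hj
    have hmp := measurePreserving_pair μ (Finset.mem_Ioi.mp hj).ne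
    refine ⟨hmp.integrable_comp_of_integrable hlog, ?_⟩
    have h := integral_map (μ := σ) hmp.measurable.aemeasurable
      (f := fun p : ℝ × ℝ => Real.log |p.1 - p.2|) (by rw [hmp.map_eq]; exact hlog.1)
    rw [hmp.map_eq] at h
    exact h.symm
  have hUi : Integrable U μ := hlog.integral_prod_left
  have hUI : ∫ x, U x ∂μ = logEnergy μ μ := (integral_prod _ hlog).symm
  have hone : ∀ i : Fin N, Integrable (fun x : Fin N → ℝ => u (x i)) σ ∧
      ∫ x, u (x i) ∂σ = 2 * P * logEnergy μ μ := by
    intro i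
    have hmp := measurePreserving_eval (fun _ : Fin N => μ) i
    refine ⟨hmp.integrable_comp_of_integrable (hUi.const_mul (2 * P)), ?_⟩
    have h := integral_map (μ := σ) hmp.measurable.aemeasurable (f := u)
      hum.aestronglyMeasurable
    rw [hmp.map_eq] at h
    rw [← hUI, ← integral_const_mul]
    exact h.symm
  have hi1 : Integrable (fun x : Fin N → ℝ =>
      2 * P / N * ∑ i, ∑ j ∈ Finset.Ioi i, Real.log |x i - x j|) σ :=
    (integrable_finsetSum _ fun i _ => integrable_finsetSum _ fun j hj =>
      (hpair i j hj).1).const_mul _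
  have hi2 : Integrable (fun x : Fin N → ℝ => ∑ i, u (x i)) σ :=
    integrable_finsetSum _ fun i _ => (hone i).1
  have hi3 : Integrable (fun x : Fin N → ℝ => N * ℓ - ∑ i, u (x i)) σ :=
    (integrable_const _).sub hi2
  have hGi : Integrable G σ := hi1.add hi3
  have hGint : ∫ x, G x ∂σ = N * ℓ - N * P * logEnergy μ μ - P * logEnergy μ μ := by
    have hcount := two_mul_sum_sum_Ioi (N := N) (fun _ _ => logEnergy μ μ) fun _ _ => rfl
    rw [hGdef, integral_add hi1 hi3, integral_const_mul, integral_sub (integrable_const _) hi2,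
      integral_finsetSum _ fun i _ => integrable_finsetSum _ fun j hj => (hpair i j hj).1,
      integral_finsetSum _ fun i _ => (hone i).1, integral_const, probReal_univ, one_smul]
    rw [Finset.sum_congr rfl fun i _ => (integral_finsetSum _ fun j hj => (hpair i j hj).1).trans
      (Finset.sum_congr rfl fun j hj => (hpair i j hj).2),
      Finset.sum_congr rfl fun i _ => (hone i).2]
    have e : 2 * P / N * ∑ i : Fin N, ∑ j ∈ Finset.Ioi i, logEnergy μ μ =
        P / N * (2 * ∑ i : Fin N, ∑ j ∈ Finset.Ioi i, logEnergy μ μ) := by ring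
    rw [e, hcount]
    simp only [Finset.sum_const, Finset.card_univ, Fintype.card_fin, nsmul_eq_mul]
    field_simp
    ring
  have hW : ∀ᵐ x ∂σ, ENNReal.ofReal (Real.exp (G x)) =
      ENNReal.ofReal ((∏ i, ∏ j ∈ Finset.Ioi i, |x i - x j| ^ (2 * P / (N : ℝ))) *
        Real.exp (N * ℓ - ∑ i, u (x i))) := by
    -- On coinciding points `e^G` uses `log 0 = 0` and differs from the vanishing product, so these
    -- points must be null.
    have hne : ∀ᵐ x ∂σ, ∀ i, ∀ j ∈ Finset.Ioi i, x i - x j ≠ 0 := by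
      rw [ae_all_iff]
      intro i
      rw [ae_all_iff]
      intro j
      by_cases hj : j ∈ Finset.Ioi i
      · have hmp := measurePreserving_pair μ (Finset.mem_Ioi.mp hj).ne
        filter_upwards [hmp.quasiMeasurePreserving.ae (ae_prod_ne μ)] with x hx _ using hx
      · exact ae_of_all _ fun x h => absurd h hj
    filter_upwards [hne] with x hx
    rw [hGdef]
    simp only []
    rw [Real.exp_add]
    congr 2
    simp_rw [Finset.mul_sum, Real.exp_sum]
    refine Finset.prod_congr rfl fun i _ => Finset.prod_congr rfl fun j hj => ?_
    rw [Real.rpow_def_of_pos (abs_pos.mpr (hx i j hj)), mul_comm]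
  rw [← hGint]
  refine (ofReal_exp_integral_le hGi).trans (le_of_eq ?_)
  rw [lintegral_congr_ae hW, hσd, lintegral_withDensity_eq_lintegral_mul, partitionFunction]
  · refine lintegral_congr fun x => ?_
    rw [Pi.mul_apply, ← ENNReal.ofReal_mul (Real.exp_nonneg _), weight]
    congr 1
    rw [mul_left_comm, ← Real.exp_add]
    congr 2
    rw [Finset.sum_sub_distrib, Finset.sum_add_distrib, Finset.sum_neg_distrib]
    simp
  · fun_prop
  · refine Measurable.ennreal_ofReal (Measurable.mul ?_ (by fun_prop))
    refine Finset.measurable_prod _ fun i _ => Finset.measurable_prod _ fun j _ => ?_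
    fun_prop

/-! ### Deviation estimate for the empirical measure -/

theorem kernelForm_regLog_nonpos {α β : Measure ℝ} (hα : HasLogMoment α) (hβ : HasLogMoment β)
    {ε : ℝ} (hε : 0 < ε) : kernelForm (regLog ε) α β ≤ 0 := by
  have := hα.isProbabilityMeasure
  have := hβ.isProbabilityMeasure
  have h : 0 ≤ -2 * kernelForm (regLog ε) α β := by
    refine ge_of_tendsto (tendsto_kernelForm_regLog hα hβ hε) ?_
    filter_upwards [tendsto_natCast_atTop_atTop.eventually_ge_atTop ε] with n hn
    have hn' : ε ≤ (n : ℝ) + 1 := by linarith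
    have h2 := (integral_mul_norm_charFun_sub (integrable_laplaceWeight hε hn') α β).2
    simp_rw [integral_laplaceWeight_mul_cos hε hn'] at h2
    rw [← h2]
    exact integral_nonneg fun t => mul_nonneg (laplaceWeight_nonneg hn' t) (by positivity)
  linarith

theorem IsTestFunction.integrable {f : ℝ → ℝ} (hf : IsTestFunction f) {μ : Measure ℝ}
    [IsProbabilityMeasure μ] (hb : HasBoundedDensity μ) : Integrable f μ := by
  obtain ⟨-, hm, -⟩ := hf
  obtain ⟨M, hM, hμ⟩ := hb
  have h := ((hm.smul_measure hM).mono_measure hμ).integrable one_le_two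
  simpa using h.re

/-- The duality bound without errors would give `-2π²r²`. One factor `2` is spent on `e^{2πε/h} ≤
2`, another on separating `r` from the mollification error. -/
theorem kernelForm_le_of_lt_dist {α β : Measure ℝ} (hα : HasLogMoment α) (hβ : HasLogMoment β)
    (hfα : ∀ f, IsTestFunction f → Integrable f α) (hfβ : ∀ f, IsTestFunction f → Integrable f β)
    {ε h r : ℝ} (hε : 0 < ε) (hh : 0 < h) (hr : 0 < r) (hεh : 4 * Real.pi * ε ≤ h)
    (hd : ENNReal.ofReal r < dist α β) :
    kernelForm (regLog ε) α β ≤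
      -(Real.pi ^ 2 * (r ^ 2 / 2)) + 4 * Real.pi ^ 2 * mollifierMoment ^ 2 * h ^ 2 := by
  rw [dist] at hd
  simp only [lt_iSup_iff] at hd
  obtain ⟨f, hf, hlt⟩ := hd
  rw [ENNReal.ofReal_lt_ofReal_iff_of_nonneg hr.le] at hlt
  have hb := abs_integral_sub_integral_le hf hα hβ (hfα f hf) (hfβ f hf) hε hh
  have hn := kernelForm_regLog_nonpos hα hβ hε
  set D := -2 * kernelForm (regLog ε) α β with hD
  have hD0 : 0 ≤ D := by linarith
  set A := mollifierMoment
  have hpi := Real.pi_pos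
  have hexp : Real.exp (2 * Real.pi * ε / h) ≤ 2 := by
    have h1 : 2 * Real.pi * ε / h ≤ 1 / 2 := by
      rw [div_le_iff₀ hh]
      linarith
    have h2 : Real.exp (1 / 2) ^ 2 ≤ 2 ^ 2 := by
      rw [← Real.exp_nat_mul]
      have := Real.exp_one_lt_d9
      norm_num at this ⊢
      linarith
    exact (Real.exp_le_exp.mpr h1).trans (le_of_sq_le_sq h2 zero_le_two)
  have hs : √(Real.exp (2 * Real.pi * ε / h) * D) ≤ √(2 * D) := by gcongr
  have h3 : r - 2 * (h * A) ≤ (2 * Real.pi)⁻¹ * √(2 * D) := by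
    have := mul_le_mul_of_nonneg_left hs (show 0 ≤ (2 * Real.pi)⁻¹ by positivity)
    linarith
  -- With `a = 2hA` this is `(r - a)² - r²/2 + a² = (r - 2a)²/2 ≥ 0`; the positive part makes it
  -- legitimate to square the preceding bound.
  have hsplit : r ^ 2 / 2 - (2 * (h * A)) ^ 2 ≤ (max (r - 2 * (h * A)) 0) ^ 2 := by
    rcases le_total 0 (r - 2 * (h * A)) with h0 | h0
    · rw [max_eq_left h0]
      nlinarith [sq_nonneg (r - 2 * (2 * (h * A)))]
    · rw [max_eq_right h0]
      nlinarith
  have h4 : (max (r - 2 * (h * A)) 0) ^ 2 ≤ ((2 * Real.pi)⁻¹ * √(2 * D)) ^ 2 := by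
    refine pow_le_pow_left₀ (le_max_right _ _) (max_le h3 (by positivity)) 2
  rw [mul_pow, Real.sq_sqrt (by linarith), inv_pow] at h4
  have h5 : r ^ 2 / 2 - (2 * (h * A)) ^ 2 ≤ ((2 * Real.pi) ^ 2)⁻¹ * (2 * D) := hsplit.trans h4
  have h6 := mul_le_mul_of_nonneg_left h5 (show 0 ≤ Real.pi ^ 2 by positivity)
  have h7 : Real.pi ^ 2 * (((2 * Real.pi) ^ 2)⁻¹ * (2 * D)) = -kernelForm (regLog ε) α β := by
    rw [hD]
    field_simp
  rw [h7] at h6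
  linarith

/-- The factors `e^{Nℓ - NP I}`, with `I` the logarithmic energy of `μ`, cancel between the bound on
the weight and the bound on the partition function. -/
theorem betaEnsemble_le {V : ℝ → ℝ} (hV : Measurable V) {P : ℝ} (hP : 0 < P) {μ : Measure ℝ}
    (hμ : HasLogMoment μ) (hb : HasBoundedDensity μ) {C : ℝ}
    (hC : ∀ ε : ℝ, 0 < ε → ∀ x : ℝ, ∫ y, regLog ε (x - y) ∂μ ≤ logPotential μ x + C * √ε)
    {ℓ : ℝ} (hg : μ = gibbs V (fun x => 2 * P * logPotential μ x) ℓ) {N : ℕ} (hN : 1 ≤ N)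
    {ε : ℝ} (hε : 0 < ε) (S : Set (Fin N → ℝ)) {κ : ℝ}
    (hS : ∀ x ∈ S, kernelForm (regLog ε) (empiricalMeasure N x) μ ≤ κ) :
    betaEnsemble V P N S ≤ ENNReal.ofReal (Real.exp (P * logEnergy μ μ +
      2 * P * N * (C * √ε) - P * Real.log ε + N * P * κ)) := by
  have := hμ.isProbabilityMeasure
  set I := logEnergy μ μ with hI
  have hum : Measurable fun x => 2 * P * logPotential μ x := (measurable_logPotential μ).const_mul _
  have hgp : IsProbabilityMeasure (gibbs V (fun x => 2 * P * logPotential μ x) ℓ) := hg ▸ this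
  set q : (Fin N → ℝ) → ℝ≥0∞ := fun x =>
    ENNReal.ofReal (Real.exp (∑ i, (-V (x i) + 2 * P * logPotential μ (x i) - ℓ))) with hq
  have hqm : Measurable q := by
    have := measurable_logPotential μ
    fun_prop
  have hq1 : ∫⁻ x, q x = 1 := by
    have h := pi_gibbs hV hum ℓ N
    have h1 := congrArg (fun m : Measure (Fin N → ℝ) => m Set.univ) h
    simp only [measure_univ] at h1
    rw [withDensity_apply _ MeasurableSet.univ, setLIntegral_univ] at h1
    exact h1.symm
  set E := N * ℓ - N * P * I + 2 * P * N * (C * √ε) - P * Real.log ε + N * P * κ with hE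
  set Z0 := Real.exp (N * ℓ - N * P * I - P * I) with hZ0
  have hup : ∫⁻ x in S, ENNReal.ofReal (weight V P N x) ≤ ENNReal.ofReal (Real.exp E) := by
    calc ∫⁻ x in S, ENNReal.ofReal (weight V P N x)
        ≤ ∫⁻ x in S, ENNReal.ofReal (Real.exp E) * q x := by
          refine setLIntegral_mono (hqm.const_mul _) fun x hx => ?_
          rw [hq, ← ENNReal.ofReal_mul (Real.exp_nonneg _)]
          refine ENNReal.ofReal_le_ofReal ((weight_le hP hμ hb hC ℓ hN hε x).trans ?_)
          refine mul_le_mul_of_nonneg_right (Real.exp_le_exp.mpr ?_) (Real.exp_nonneg _)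
          have := mul_le_mul_of_nonneg_left (hS x hx) (show 0 ≤ N * P by positivity)
          linarith
      _ ≤ ∫⁻ x, ENNReal.ofReal (Real.exp E) * q x := setLIntegral_le_lintegral _ _
      _ = ENNReal.ofReal (Real.exp E) := by rw [lintegral_const_mul _ hqm, hq1, mul_one]
  have hZ := le_partitionFunction hV hμ hb hg hN
  -- `withDensity_apply'` asks for no measurability of `S`; the event of interest is defined by an
  -- uncountable supremum.
  rw [betaEnsemble, Measure.smul_apply, withDensity_apply', smul_eq_mul]
  calc (partitionFunction V P N)⁻¹ * ∫⁻ x in S, ENNReal.ofReal (weight V P N x)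
      ≤ (ENNReal.ofReal Z0)⁻¹ * ENNReal.ofReal (Real.exp E) := by
        gcongr
    _ = _ := by
        rw [← ENNReal.ofReal_inv_of_pos (Real.exp_pos _), ← Real.exp_neg,
          ← ENNReal.ofReal_mul (Real.exp_nonneg _), ← Real.exp_add]
        congr 2
        rw [hE]
        ring

end HighTempBeta

end

/-! ### Choice of the scales and conclusion -/

open HighTempBeta in
theorem proposition1p4 (V : ℝ → ℝ) (P : ℝ) (hP : 0 < P) (μ : MeasureTheory.Measure ℝ)
    (hμ : HighTempBeta.IsEquilibriumMeasure V P μ)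
    (hV : HighTempBeta.PotentialAssumptions V μ) :
    ∃ K : ℝ, ∀ N : ℕ, 1 ≤ N → ∀ r : ℝ, 0 < r →
      HighTempBeta.betaEnsemble V P N
          {x | ENNReal.ofReal r < HighTempBeta.dist (HighTempBeta.empiricalMeasure N x) μ} ≤
        ENNReal.ofReal (Real.exp
          (-((N : ℝ) * r ^ 2 * (P * Real.pi ^ 2 / 2)) + 5 * P * Real.log (N : ℝ) + K)) := by
  have hVc : Continuous V := hV.contDiff.continuous
  have hdec := exists_exp_neg_add_le hVc fun α hα => by
    simpa using hV.poly_isLittleO 1 α hα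
  obtain ⟨hlog, hb, ℓ, hg⟩ := equilibrium_eq_gibbs hVc.measurable hdec hP hμ
  obtain ⟨C, hC0, hC⟩ := exists_integral_regLog_le hlog hb
  have := hlog.isProbabilityMeasure
  have hpi := Real.pi_pos
  -- The summands come from the Jensen loss, from regularising the potential (`N√ε = 1`) and from
  -- mollification (`4π²·16² = 1024π²`, with a spare factor `1/N`).
  refine ⟨P * logEnergy μ μ + 2 * P * C + 1024 * P * Real.pi ^ 2 * mollifierMoment ^ 2,
    fun N hN r hr => ?_⟩
  have hN1 : (1 : ℝ) ≤ N := by exact_mod_cast hN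
  have hN0 : (0 : ℝ) < N := by linarith
  -- With `ε = N⁻²` the diagonal costs `2P log N`, within the allowed `5P log N`. The constant in `h
  -- = 16/N` ensures `4πε ≤ h`, because `π ≤ 4`.
  have hε : (0 : ℝ) < ((N : ℝ) ^ 2)⁻¹ := by positivity
  have hh : (0 : ℝ) < 16 / N := by positivity
  have hεh : 4 * Real.pi * ((N : ℝ) ^ 2)⁻¹ ≤ 16 / N := by
    rw [← div_eq_mul_inv, div_le_div_iff₀ (by positivity) hN0]
    have := Real.pi_le_four
    nlinarith [mul_le_mul_of_nonneg_left hN1 hN0.le]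
  refine (betaEnsemble_le hVc.measurable hP hlog hb hC hg hN hε _ fun x hx =>
    kernelForm_le_of_lt_dist (hasLogMoment_empiricalMeasure hN x) hlog
      (fun f _ => integrable_empiricalMeasure hN x f) (fun f hf => hf.integrable hb)
      hε hh hr hεh hx).trans ?_
  refine ENNReal.ofReal_le_ofReal (Real.exp_le_exp.mpr ?_)
  have hlogN := Real.log_nonneg hN1
  have hsqrt : √(((N : ℝ) ^ 2)⁻¹) = (N : ℝ)⁻¹ := by
    rw [Real.sqrt_inv, Real.sqrt_sq hN0.le]
  rw [hsqrt, Real.log_inv, Real.log_pow]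
  have e1 : 2 * P * N * (C * (N : ℝ)⁻¹) = 2 * P * C := by field_simp
  have e2 : N * P * (-(Real.pi ^ 2 * (r ^ 2 / 2)) +
      4 * Real.pi ^ 2 * mollifierMoment ^ 2 * (16 / N) ^ 2) =
      -((N : ℝ) * r ^ 2 * (P * Real.pi ^ 2 / 2)) +
        1024 * P * Real.pi ^ 2 * mollifierMoment ^ 2 * (1 / N) := by
    field_simp
    ring
  have e3 : 1024 * P * Real.pi ^ 2 * mollifierMoment ^ 2 * (1 / N) ≤
      1024 * P * Real.pi ^ 2 * mollifierMoment ^ 2 := by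
    refine mul_le_of_le_one_right (by positivity) ?_
    rw [div_le_one hN0]
    exact hN1
  rw [e1, e2]
  have e4 := mul_nonneg hP.le hlogN
  push_cast
  linarith
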